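/- Let $N$ be a positive integer and let $dU$ be the Haar measure on the unitary group $U(N)$, normalised by $\int dU=1$. For $A\in\mathbb{C}^{N\times N}$ with eigenvalues $\lambda_1,\dots,\lambda_N$ (counted with algebraic multiplicity) put $\det[A]^\alpha:=\prod_{j=1}^N\lambda_j^\alpha$ with principal powers; thus $\det[1\pm U^\dagger]^\alpha=\prod_{j=1}^N(1\pm t_j^{-1})^\alpha$, where $t_1,\dots,t_N$ are the eigenvalues of $U$. Let $\alpha,b\in\mathbb{C}$ with $\operatorname{Re}(\alpha)>-1$. Then, for each choice of the sign, the function $U\mapsto\det[1\pm U^\dagger]^\alpha\exp(b\operatorname{Tr}U)$ is integrable with respect to $dU$ and $$\int dU\,\det\left[1\pm U^\dagger\right]^\alpha\exp\left(b\operatorname{Tr}U\right)=\det_{1\le j,k\le N}\left[\binom{\alpha}{j-k}\,{}_1F_1\left(-\alpha+j-k;\,j-k+1;\,\mp b\right)\right].$$ Here $\binom{\alpha}{s}=\frac{\Gamma(\alpha+1)}{\Gamma(s+1)\Gamma(\alpha-s+1)}$ and ${}_1F_1(a;c;z)=\sum_{m=0}^\infty\frac{(a)_m}{(c)_m}\frac{z^m}{m!}$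 with $(a)_m=a(a+1)\cdots(a+m-1)$. The matrix entries are understood after cancellation of the common factor $\Gamma(j-k+1)$, that is, with $m=j-k$, $$\binom{\alpha}{m}\,{}_1F_1(-\alpha+m;m+1;z)=\frac{\Gamma(\alpha+1)}{\Gamma(\alpha-m+1)}\sum_{l=0}^\infty\frac{(m-\alpha)_l}{\Gamma(m+1+l)}\frac{z^l}{l!},\qquad \frac{1}{\Gamma(-n)}:=0\ \text{ for } n=0,1,2,\dots,$$ which is the product itself for $m\ge 0$ and the limit of $\binom{\alpha}{s}\,{}_1F_1(-\alpha+s;s+1;z)$ as $s\to m$ for $m<0$. -/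

import Mathlib

open MeasureTheory Filter Topology

/-- The Borel `σ`-algebra on the unitary group `U(N)`. -/
noncomputable instance unitaryMeasurableSpace (N : ℕ) : MeasurableSpace (Matrix.unitaryGroup (Fin N) ℂ) :=
  borel _

instance unitaryBorelSpace (N : ℕ) : BorelSpace (Matrix.unitaryGroup (Fin N) ℂ) := ⟨rfl⟩

instance unitaryCompactSpace (N : ℕ) : CompactSpace (Matrix.unitaryGroup (Fin N) ℂ) := by
  refine (isCompact_iff_compactSpace
    (s := (Matrix.unitaryGroup (Fin N) ℂ : Set (Matrix (Fin N) (Fin N) ℂ)))).1 ?_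
  have hK : IsCompact (Set.univ.pi fun _ : Fin N =>
      Set.univ.pi fun _ : Fin N => Metric.closedBall (0 : ℂ) 1) :=
    isCompact_univ_pi fun _ => isCompact_univ_pi fun _ => isCompact_closedBall _ _
  refine IsCompact.of_isClosed_subset (s := (Set.univ.pi fun _ : Fin N =>
      Set.univ.pi fun _ : Fin N => Metric.closedBall (0 : ℂ) 1 : Set (Matrix (Fin N) (Fin N) ℂ)))
      hK ?_ ?_
  · have h : ((Matrix.unitaryGroup (Fin N) ℂ : Set (Matrix (Fin N) (Fin N) ℂ))) =
        {A | star A * A = 1} ∩ {A | A * star A = 1} := by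
      ext A
      exact Unitary.mem_iff
    rw [h]
    exact (isClosed_eq (by fun_prop) continuous_const).inter
      (isClosed_eq (by fun_prop) continuous_const)
  · intro A hA i _ j _
    simpa using entry_norm_bound_of_unitary hA i j

/-- The Haar measure `dU_N` of the unitary group `U(N)`, normalised by `∫ dU_N = 1`. -/
noncomputable def haarU (N : ℕ) : Measure (Matrix.unitaryGroup (Fin N) ℂ) :=
  Measure.haarMeasure ⊤

instance haarU_isProbabilityMeasure (N : ℕ) : IsProbabilityMeasure (haarU N) :=
  ⟨by simpa [haarU] using
    (Measure.haarMeasure_self (K₀ := (⊤ : TopologicalSpace.PositiveCompacts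
      (Matrix.unitaryGroup (Fin N) ℂ))))⟩

/-- The complex power `det[A]^α` of a determinant, understood as the product of the principal
powers `λ^α` of the eigenvalues `λ` of `A`, counted with algebraic multiplicity.  So
`det[1 ± U†]^α = ∏_j (1 ± t_j⁻¹)^α`, where the `t_j` are the eigenvalues of the unitary
matrix `U`. -/
noncomputable def detCpow {N : ℕ} (A : Matrix (Fin N) (Fin N) ℂ) (α : ℂ) : ℂ :=
  (A.charpoly.roots.map fun t => t ^ α).prod

/-- The integrand `det[1 + ε U†]^α exp(b Tr U)`; the sign is `ε = 1` or `ε = -1`. -/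
noncomputable def inghamSiegelIntegrand {N : ℕ} (ε α b : ℂ)
    (U : Matrix.unitaryGroup (Fin N) ℂ) : ℂ :=
  detCpow (1 + ε • star (U : Matrix (Fin N) (Fin N) ℂ)) α *
    Complex.exp (b * Matrix.trace (U : Matrix (Fin N) (Fin N) ℂ))

/-- The binomial coefficient `Γ(α+1) / (Γ(s+1) Γ(α-s+1))` with complex arguments. -/
noncomputable def complexBinom (α s : ℂ) : ℂ :=
  Complex.Gamma (α + 1) / (Complex.Gamma (s + 1) * Complex.Gamma (α - s + 1))

/-- Kummer's confluent hypergeometric function `₁F₁(a; b; z)`, the quotients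
`Γ(a+m)/Γ(a)` and `Γ(b+m)/Γ(b)` being written as rising factorials.  It is meant for `b` not a
non-positive integer. -/
noncomputable def kummer (a b z : ℂ) : ℂ :=
  ∑' m : ℕ, (ascPochhammer ℂ m).eval a / (ascPochhammer ℂ m).eval b * (z ^ m / (m.factorial : ℂ))

/-- The product `binom(α, s) · ₁F₁(s-α; s+1; z)` after the factor `Γ(s+1)`, which occurs in the
denominator of the binomial coefficient and in the numerators of the Kummer series, has been
cancelled.  This gives the product its meaning also for negative integers `s`, where the binomial
coefficient vanishes and `₁F₁` has a pole: see `binomKummer_eq_mul` and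
`tendsto_complexBinom_mul_kummer`. -/
noncomputable def binomKummer (α s z : ℂ) : ℂ :=
  Complex.Gamma (α + 1) / Complex.Gamma (α - s + 1) *
    ∑' m : ℕ, (ascPochhammer ℂ m).eval (s - α) / Complex.Gamma (s + 1 + m) *
      (z ^ m / (m.factorial : ℂ))

theorem Gamma_add_natCast_eq (s : ℂ) (hs : ∀ n : ℕ, s ≠ -n) (m : ℕ) :
    Complex.Gamma (s + m) = Complex.Gamma s * (ascPochhammer ℂ m).eval s := by
  induction m with
  | zero => simp
  | succ m ih =>
    have h : s + m ≠ 0 := fun h => hs m (eq_neg_of_add_eq_zero_left h)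
    rw [Nat.cast_succ, ← add_assoc, Complex.Gamma_add_one _ h, ih, ascPochhammer_succ_eval]
    ring

/-- Away from the negative integers `binomKummer` is literally the product. -/
theorem binomKummer_eq_mul (α s z : ℂ) (hs : ∀ n : ℕ, s + 1 ≠ -n) :
    binomKummer α s z = complexBinom α s * kummer (s - α) (s + 1) z := by
  have h0 : Complex.Gamma (s + 1) ≠ 0 := Complex.Gamma_ne_zero hs
  have : kummer (s - α) (s + 1) z = Complex.Gamma (s + 1) *
      ∑' m : ℕ, (ascPochhammer ℂ m).eval (s - α) / Complex.Gamma (s + 1 + m) *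
        (z ^ m / (m.factorial : ℂ)) := by
    rw [kummer, ← tsum_mul_left]
    refine tsum_congr fun m => ?_
    rw [Gamma_add_natCast_eq _ hs, ← mul_assoc, ← mul_div_assoc (Complex.Gamma (s + 1)),
      mul_div_mul_left _ _ h0]
  rw [this, binomKummer, complexBinom]
  field_simp

theorem norm_ascPochhammer_le (a : ℂ) (C : ℝ) (ha : ‖a‖ ≤ C) (m : ℕ) :
    ‖(ascPochhammer ℂ m).eval a‖ ≤ (C + 1) ^ m * m.factorial := by
  have hC : 0 ≤ C := (norm_nonneg a).trans ha
  induction m with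
  | zero => simp
  | succ m ih =>
    rw [ascPochhammer_succ_eval, norm_mul]
    have h : ‖a + m‖ ≤ (C + 1) * (m + 1) := by
      have := norm_add_le a (m : ℂ)
      rw [Complex.norm_natCast] at this
      nlinarith [mul_nonneg hC (Nat.cast_nonneg (α := ℝ) m)]
    calc _ ≤ ((C + 1) ^ m * m.factorial) * ((C + 1) * (m + 1)) := by gcongr
      _ = _ := by push_cast [Nat.factorial_succ]; ring

theorem factorial_le_norm_ascPochhammer (a : ℂ) (ha : 1 ≤ a.re) (m : ℕ) :
    (m.factorial : ℝ) ≤ ‖(ascPochhammer ℂ m).eval a‖ := by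
  induction m with
  | zero => simp
  | succ m ih =>
    rw [ascPochhammer_succ_eval, norm_mul, Nat.factorial_succ, Nat.cast_mul, mul_comm]
    have h : ((m + 1 : ℕ) : ℝ) ≤ ‖a + m‖ := by
      refine le_trans ?_ (Complex.re_le_norm _)
      simp
      linarith
    gcongr

theorem continuous_binomKummer (α z : ℂ) : Continuous fun s => binomKummer α s z := by
  unfold binomKummer
  have hG : Continuous fun s : ℂ => (Complex.Gamma s)⁻¹ :=
    Complex.differentiable_one_div_Gamma.continuous
  refine Continuous.mul ?_ ?_
  · simp only [div_eq_mul_inv]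
    exact continuous_const.mul (hG.comp (by fun_prop))
  set T : ℕ → ℂ → ℂ := fun m s => (ascPochhammer ℂ m).eval (s - α) / Complex.Gamma (s + 1 + m) *
      (z ^ m / (m.factorial : ℂ)) with hT
  change Continuous fun s => ∑' m, T m s
  have hTc : ∀ m, Continuous (T m) := fun m => by
    simp only [hT, div_eq_mul_inv]
    exact (((ascPochhammer ℂ m).continuous.comp (by fun_prop)).mul
      (hG.comp (by fun_prop))).mul continuous_const
  rw [continuous_iff_continuousAt]
  intro s₀
  obtain ⟨K, hK⟩ := exists_nat_gt (‖s₀‖)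
  set B : Set ℂ := Metric.closedBall 0 K with hB
  have hBn : B ∈ 𝓝 s₀ := Metric.closedBall_mem_nhds_of_mem (by simpa using hK)
  obtain ⟨M, hM⟩ := (isCompact_closedBall (0 : ℂ) (K : ℝ)).exists_bound_of_continuousOn
    (f := fun s => (Complex.Gamma (s + 1 + K))⁻¹) (hG.comp (by fun_prop)).continuousOn
  set C : ℝ := K + ‖α‖ with hC
  have hC0 : 0 ≤ C := by positivity
  set u : ℕ → ℝ := fun n => (M * ((C + 1) * ‖z‖) ^ K) * (((C + 1) * ‖z‖) ^ n / n.factorial) with hu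
  have hus : Summable u := (Real.summable_pow_div_factorial _).mul_left _
  have hbound : ∀ n, ∀ s ∈ B, ‖T (n + K) s‖ ≤ u n := by
    intro n s hs
    have hs' : ‖s‖ ≤ K := by simpa [hB] using hs
    have hre : 1 ≤ (s + 1 + K).re := by
      have := (abs_le.1 ((Complex.abs_re_le_norm s).trans hs')).1
      simp
      linarith
    have hne : ∀ j : ℕ, s + 1 + K ≠ -j := fun j h => by
      rw [h] at hre
      simp at hre
      linarith [(Nat.cast_nonneg j : (0 : ℝ) ≤ j)]
    have h1 : ‖(ascPochhammer ℂ (n + K)).eval (s - α)‖ ≤ (C + 1) ^ (n + K) * (n + K).factorial :=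
      norm_ascPochhammer_le _ _ ((norm_sub_le _ _).trans (by rw [hC]; gcongr)) _
    have h2 : ‖(Complex.Gamma (s + 1 + (n + K : ℕ)))⁻¹‖ ≤ M / n.factorial := by
      have : s + 1 + ((n + K : ℕ) : ℂ) = s + 1 + K + n := by push_cast; ring
      rw [this, Gamma_add_natCast_eq _ hne, mul_inv, norm_mul, div_eq_mul_inv, norm_inv
        ((ascPochhammer ℂ n).eval _)]
      have hf : (0 : ℝ) < n.factorial := by positivity
      exact mul_le_mul (hM s hs) (inv_anti₀ hf (factorial_le_norm_ascPochhammer _ hre n))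
        (by positivity) ((norm_nonneg _).trans (hM s hs))
    have hM0 : 0 ≤ M := (norm_nonneg _).trans (hM s hs)
    have hf : (0 : ℝ) < (n + K).factorial := by positivity
    simp only [hT, hu, div_eq_mul_inv _ (Complex.Gamma _)]
    rw [norm_mul, norm_mul, norm_div, norm_pow, Complex.norm_natCast]
    calc _ ≤ ((C + 1) ^ (n + K) * (n + K).factorial) * (M / n.factorial) *
          (‖z‖ ^ (n + K) / (n + K).factorial) := by gcongr
      _ = _ := by
        rw [mul_pow (C + 1), mul_pow (C + 1), pow_add, pow_add]
        field_simp
  clear_value T u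
  have htail : ContinuousOn (fun s => ∑' n, T (n + K) s) B :=
    continuousOn_tsum (fun n => (hTc _).continuousOn) hus hbound
  have heq : Set.EqOn (fun s => ∑' m, T m s)
      (fun s => ∑ m ∈ Finset.range K, T m s + ∑' n, T (n + K) s) B := by
    intro s hs
    have hsum : Summable fun n => T (n + K) s :=
      Summable.of_norm_bounded hus fun n => hbound n s hs
    exact (((summable_nat_add_iff K).1 hsum).sum_add_tsum_nat_add K).symm
  have : ContinuousOn (fun s => ∑' m, T m s) B :=
    ((continuous_finsetSum _ fun m _ => hTc m).continuousOn.add htail).congr heq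
  exact this.continuousAt hBn

/-- At every integer `m`, in particular at the negative ones, `binomKummer` is the limit of
`binom(α, s) · ₁F₁(s-α; s+1; z)` as `s` tends to `m`. -/
theorem tendsto_complexBinom_mul_kummer (α z : ℂ) (m : ℤ) :
    Tendsto (fun s => complexBinom α s * kummer (s - α) (s + 1) z) (𝓝[≠] (m : ℂ))
      (𝓝 (binomKummer α m z)) := by
  refine (((continuous_binomKummer α z).tendsto m).mono_left nhdsWithin_le_nhds).congr' ?_
  have hball : Metric.ball (m : ℂ) 1 ∈ 𝓝 (m : ℂ) := Metric.ball_mem_nhds _ one_pos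
  filter_upwards [self_mem_nhdsWithin, mem_nhdsWithin_of_mem_nhds hball] with s hs hs'
  refine binomKummer_eq_mul α s z fun n hn => hs ?_
  have hsn : s = ((-n - 1 : ℤ) : ℂ) := by push_cast; linear_combination hn
  rw [hsn, Metric.mem_ball, dist_eq_norm, ← Int.cast_sub, Complex.norm_intCast,
    ← Int.cast_abs] at hs'
  have : |(-n - 1 : ℤ) - m| < 1 := by exact_mod_cast hs'
  rw [Set.mem_singleton_iff, hsn, sub_eq_zero.1 (Int.abs_lt_one_iff.1 this)]

/-! The integrand is a class function: it is the product over the eigenvalues `t` of `U` of the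
symbol `f(t) = (1 + ε/t)^α e^{bt}`. By the Heine–Szegő identity, the Haar integral of `∏ f(t_j)` is
the Toeplitz determinant of the Fourier coefficients of `f`. Convolving the binomial coefficients of
`(1 + ε/t)^α` with the coefficients of `e^{bt}` gives a Kummer series. The remaining powers of `ε`
are removed by conjugation with a diagonal matrix.

The Heine–Szegő identity is proved here by loop (Schwinger–Dyson) equations rather than through
Weyl's integration formula. For `s ∈ ℤ^N` let `M(s)` be the Haar integral of the polarised
determinant of `U^{s_1}, …, U^{s_N}`. Invariance of Haar measure makes integrals of derivatives
vanish. Contracting these derivatives over the matrix units gives linear relations between the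
`M(s)` (`haar_loop_equation`). The constant term of `t^s ∏_{a≠b} (1 - t_a/t_b)` satisfies the same
relations, because the constant term of `t_k ∂/∂t_k` of anything is zero
(`constTerm_loop_equation`). The relations determine a symmetric function on `ℤ^N` from its value at
the origin (`eq_zero_of_loop_equations`). Expanding the Weyl weight as a product of two Vandermonde
determinants turns the constant term into a polarised Toeplitz determinant, whence
`integral_mixedPow`.

By multilinearity this gives Heine–Szegő for Laurent polynomial symbols. Uniform approximation
extends it to continuous symbols, and a cutoff with Fatou's lemma to the integrable symbol at hand,
which may blow up at `t = -ε`. The Fourier coefficients of `(1 + z)^α` on the circle are limits from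
radii `r < 1`, with integrable domination for `Re α > -1`. -/

/-! ### Signed sums over integer intervals -/

/-- The signed sum `∑_{0 < l ≤ s} g l`, meaning `-∑_{s < l ≤ 0} g l` for negative `s`. -/
noncomputable def zsum {A : Type*} [AddCommGroup A] (g : ℤ → A) (s : ℤ) : A :=
  ∑ l ∈ Finset.Ioc 0 s, g l - ∑ l ∈ Finset.Ioc s 0, g l

section zsum

variable {A B : Type*} [AddCommGroup A] [AddCommGroup B]

@[simp] theorem zsum_zero (g : ℤ → A) : zsum g 0 = 0 := by simp [zsum]

theorem sum_Ioc_add_one (g : ℤ → A) {a b : ℤ} (h : a ≤ b) :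
    ∑ l ∈ Finset.Ioc a (b + 1), g l = ∑ l ∈ Finset.Ioc a b, g l + g (b + 1) := by
  have : Finset.Ioc a (b + 1) = insert (b + 1) (Finset.Ioc a b) := by
    ext x; simp only [Finset.mem_Ioc, Finset.mem_insert]; omega
  rw [this, Finset.sum_insert (by simp), add_comm]

theorem sum_Ioc_eq_add_left (g : ℤ → A) {a b : ℤ} (h : a < b) :
    ∑ l ∈ Finset.Ioc a b, g l = g (a + 1) + ∑ l ∈ Finset.Ioc (a + 1) b, g l := by
  have : Finset.Ioc a b = insert (a + 1) (Finset.Ioc (a + 1) b) := by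
    ext x; simp only [Finset.mem_Ioc, Finset.mem_insert]; omega
  rw [this, Finset.sum_insert (by simp)]

theorem zsum_add_one (g : ℤ → A) (s : ℤ) : zsum g (s + 1) = zsum g s + g (s + 1) := by
  unfold zsum
  rcases le_or_gt 0 s with h | h
  · rw [sum_Ioc_add_one g h, Finset.Ioc_eq_empty (by omega : ¬ s < 0),
      Finset.Ioc_eq_empty (by omega : ¬ s + 1 < 0)]
    simp
  · rw [sum_Ioc_eq_add_left g h, Finset.Ioc_eq_empty (by omega : ¬ 0 < s),
      Finset.Ioc_eq_empty (by omega : ¬ 0 < s + 1)]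
    simp

theorem zsum_sub_one (g : ℤ → A) (s : ℤ) : zsum g (s - 1) = zsum g s - g s := by
  have := zsum_add_one g (s - 1)
  rw [sub_add_cancel] at this
  rw [this, add_sub_cancel_right]

theorem map_zsum (φ : A →+ B) (g : ℤ → A) (s : ℤ) : φ (zsum g s) = zsum (fun l => φ (g l)) s := by
  simp [zsum]

theorem zsum_sub_distrib (g h : ℤ → A) (s : ℤ) :
    zsum (fun l => g l - h l) s = zsum g s - zsum h s := by
  simp only [zsum, Finset.sum_sub_distrib]; abel

theorem zsum_neg (g : ℤ → A) (s : ℤ) : zsum (fun l => -g l) s = -zsum g s := by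
  simp only [zsum, Finset.sum_neg_distrib]; abel

theorem zsum_finset_sum {ι : Type*} (F : Finset ι) (g : ι → ℤ → A) (s : ℤ) :
    zsum (fun l => ∑ i ∈ F, g i l) s = ∑ i ∈ F, zsum (g i) s := by
  simp only [zsum, Finset.sum_sub_distrib]
  rw [Finset.sum_comm, Finset.sum_comm (s := Finset.Ioc s 0)]

theorem zsum_add_distrib (g h : ℤ → A) (s : ℤ) :
    zsum (fun l => g l + h l) s = zsum g s + zsum h s := by
  simp only [zsum, Finset.sum_add_distrib]; abel

theorem zsum_const (a : A) (s : ℤ) : zsum (fun _ => a) s = s • a := by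
  simp only [zsum, Finset.sum_const, Int.card_Ioc]
  rcases le_total 0 s with h | h
  · simp only [sub_zero, zero_sub, Int.toNat_eq_zero.2 (neg_nonpos.2 h), zero_smul]
    rw [← natCast_zsmul, Int.toNat_of_nonneg h]
  · simp only [sub_zero, zero_sub, Int.toNat_eq_zero.2 h, zero_smul]
    rw [← natCast_zsmul, Int.toNat_of_nonneg (by omega), neg_smul, neg_neg]

/-- `zsum g` is a discrete primitive of `g`, so its increments are ordinary interval sums whatever
the signs of the endpoints. -/
theorem zsum_sub_zsum_of_le (g : ℤ → A) {p q : ℤ} (h : q ≤ p) :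
    zsum g p - zsum g q = ∑ l ∈ Finset.Ioc q p, g l := by
  obtain ⟨n, rfl⟩ : ∃ n : ℕ, p = q + n := ⟨(p - q).toNat, by omega⟩
  clear h
  induction n with
  | zero => simp
  | succ n ih =>
    push_cast
    rw [← add_assoc, zsum_add_one, sum_Ioc_add_one g (by omega), ← ih]
    abel

/-- Second differences telescope. -/
theorem zsum_sub_zsum_second_diff (j : ℤ → A) (p q : ℤ) :
    zsum (fun l => j l + j l - j (l + 1) - j (l - 1)) p -
      zsum (fun l => j l + j l - j (l + 1) - j (l - 1)) q =
    (j p - j (p + 1)) - (j q - j (q + 1)) := by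
  have key : ∀ s, zsum (fun l => j l + j l - j (l + 1) - j (l - 1)) s =
      (j s - j (s + 1)) - (j 0 - j 1) := by
    intro s
    induction s using Int.induction_on with
    | zero => simp
    | succ n ih => rw [zsum_add_one, ih, add_sub_cancel_right]; abel
    | pred n ih => rw [zsum_sub_one, ih, sub_add_cancel]; abel
  rw [key, key]; abel

end zsum

/-! ### Uniqueness for the loop equations -/

/-- A symmetric function on `ℤ^n` obeying the loop equations of the unitary group vanishes if it
vanishes at the origin. -/
theorem eq_zero_of_loop_equations {n : Type*} [Fintype n] [DecidableEq n] (M : (n → ℤ) → ℂ)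
    (hsymm : ∀ (π : Equiv.Perm n) s, M (s ∘ π) = M s)
    (hloop : ∀ (s : n → ℤ) (k : n), (s k : ℂ) * M s + ∑ i ∈ Finset.univ.erase k,
      (zsum (fun l => M (Function.update (Function.update s k l) i (s k + s i - l))) (s k) -
       zsum (fun l => M (Function.update (Function.update s k l) i (s k + s i - l))) (s i)) = 0)
    (h0 : M 0 = 0) (s : n → ℤ) : M s = 0 := by
  -- Induction on a bound for `∑ s_i²`: at an index with `|s k|` maximal, the loop equation
  -- involves, besides `M s`, only points with a smaller sum of squares.
  obtain ⟨d, hd⟩ : ∃ d : ℕ, ∑ i, s i ^ 2 < d := by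
    obtain ⟨d, hd⟩ := exists_nat_gt (∑ i, s i ^ 2)
    exact ⟨d, hd⟩
  induction d generalizing s with
  | zero => exact absurd hd (not_lt.2 (by positivity))
  | succ d ih =>
    by_cases hs : s = 0
    · rw [hs, h0]
    have hne : Nonempty n := by
      by_contra h
      rw [not_nonempty_iff] at h
      exact hs (Subsingleton.elim _ _)
    obtain ⟨k, hk⟩ := Finite.exists_max fun i => |s i|
    have hk0 : s k ≠ 0 := by
      intro h
      refine hs (funext fun i => ?_)
      have := hk i
      rw [h, abs_zero] at this
      simpa using this
    have hsq : ∀ i ≠ k, ∀ a b : ℤ, ∑ j, (Function.update (Function.update s k a) i b) j ^ 2 =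
        ∑ j, s j ^ 2 - s k ^ 2 - s i ^ 2 + a ^ 2 + b ^ 2 := by
      intro i hi a b
      have hki : k ∈ Finset.univ.erase i := by simp [hi.symm]
      rw [← Finset.add_sum_erase _ _ (Finset.mem_univ i), ← Finset.add_sum_erase _ _ hki,
        ← Finset.add_sum_erase _ (fun j => s j ^ 2) (Finset.mem_univ i),
        ← Finset.add_sum_erase _ (fun j => s j ^ 2) hki]
      have : ∑ j ∈ (Finset.univ.erase i).erase k,
          (Function.update (Function.update s k a) i b) j ^ 2 =
          ∑ j ∈ (Finset.univ.erase i).erase k, s j ^ 2 := by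
        refine Finset.sum_congr rfl fun j hj => ?_
        simp only [Finset.mem_erase, Finset.mem_univ, and_true] at hj
        rw [Function.update_of_ne hj.2, Function.update_of_ne hj.1]
      rw [this]
      simp only [Function.update_self, Function.update_of_ne hi.symm]
      ring
    have hend : ∀ i ≠ k, M (Function.update (Function.update s k (s i)) i (s k)) = M s := by
      intro i hi
      rw [← hsymm (Equiv.swap k i) s]
      congr 1
      ext j
      by_cases h1 : j = i
      · subst h1; simp
      · by_cases h2 : j = k
        · subst h2; simp [h1]
        · simp [h1, h2, Equiv.swap_apply_of_ne_of_ne h2 h1]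
    -- the coefficient of `M s` in the loop equation
    have hterm : ∀ i ∈ Finset.univ.erase k, ∃ e : ℕ,
        zsum (fun l => M (Function.update (Function.update s k l) i (s k + s i - l))) (s k) -
        zsum (fun l => M (Function.update (Function.update s k l) i (s k + s i - l))) (s i) =
        ((SignType.sign (s k) : ℤ) : ℂ) * e * M s := by
      intro i hi
      have hi : i ≠ k := Finset.ne_of_mem_erase hi
      have hki := hk i
      -- Replacing `s k, s i` by `l, s k + s i - l` changes the sum of squares by `2 (l - s k)(l - s
      -- i)`, which is negative for `l` strictly between them.
      have hsmall : ∀ l, (l < s k ∧ s i < l) ∨ (s k < l ∧ l < s i) →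
          M (Function.update (Function.update s k l) i (s k + s i - l)) = 0 := by
        intro l hl
        refine ih _ ?_
        rw [hsq i hi]
        push_cast at hd
        have : (l - s k) * (l - s i) < 0 := by
          rcases hl with ⟨h1, h2⟩ | ⟨h1, h2⟩ <;> nlinarith
        nlinarith
      -- Maximality of `|s k|` forces `s k > 0` if `s i < s k`, and `s k < 0` if `s k < s i`. One
      -- endpoint of the interval survives, `l = s k` or `l = s i`, and by symmetry of `M` it
      -- contributes `M s` with the sign of `s k`.
      rcases lt_trichotomy (s i) (s k) with h | h | h
      · have hpos : 0 < s k := by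
          by_contra hneg
          have h1 := abs_of_nonpos (not_lt.1 hneg)
          have h2 := abs_of_nonpos (h.le.trans (not_lt.1 hneg))
          omega
        refine ⟨1, ?_⟩
        rw [zsum_sub_zsum_of_le _ h.le, Finset.sum_eq_single (s k)]
        · simp [sign_pos hpos, add_sub_cancel_left]
        · intro l hl hl'
          simp only [Finset.mem_Ioc] at hl
          exact hsmall l (Or.inl ⟨by omega, by omega⟩)
        · intro hl; simp [h] at hl
      · exact ⟨0, by rw [h]; simp⟩
      · have hneg : s k < 0 := by
          by_contra hpos
          have h1 := abs_of_nonneg (not_lt.1 hpos)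
          have h2 := abs_of_nonneg ((not_lt.1 hpos).trans h.le)
          omega
        refine ⟨1, ?_⟩
        rw [← neg_sub, zsum_sub_zsum_of_le _ h.le, Finset.sum_eq_single (s i)]
        · simp [sign_neg hneg, hend i hi]
        · intro l hl hl'
          simp only [Finset.mem_Ioc] at hl
          exact hsmall l (Or.inr ⟨by omega, by omega⟩)
        · intro hl; simp [h] at hl
    choose! e he using hterm
    have hl := hloop s k
    rw [Finset.sum_congr rfl he] at hl
    have habs : (s k : ℂ) = ((SignType.sign (s k) : ℤ) : ℂ) * ((s k).natAbs : ℂ) := by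
      rcases lt_or_gt_of_ne hk0 with h | h
      · rw [sign_neg h]
        have : (s k : ℤ) = -((s k).natAbs : ℤ) := by omega
        have := congrArg (Int.cast (R := ℂ)) this
        simpa using this
      · rw [sign_pos h]
        have : (s k : ℤ) = ((s k).natAbs : ℤ) := by omega
        have := congrArg (Int.cast (R := ℂ)) this
        simpa using this
    rw [habs, ← Finset.sum_mul, ← Finset.mul_sum, ← add_mul, ← mul_add] at hl
    have hsgn : ((SignType.sign (s k) : ℤ) : ℂ) ≠ 0 := by
      rcases lt_or_gt_of_ne hk0 with h | h
      · simp [sign_neg h]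
      · simp [sign_pos h]
    -- All contributions have the sign of `s k`, so nothing cancels and the coefficient of `M s` is
    -- at least `|s k| > 0` in absolute value.
    have hcoef : ((s k).natAbs : ℂ) + ∑ i ∈ Finset.univ.erase k, (e i : ℂ) ≠ 0 := by
      have : (((s k).natAbs + ∑ i ∈ Finset.univ.erase k, e i : ℕ) : ℂ) ≠ 0 := by
        have := Int.natAbs_pos.2 hk0
        exact_mod_cast (by omega)
      simpa using this
    exact (mul_eq_zero.1 hl).resolve_left (mul_ne_zero hsgn hcoef)

/-! ### The polarised determinant -/

section mixedDet

variable {n R : Type*} [Fintype n] [DecidableEq n] [CommRing R]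

/-- The full polarisation of the determinant, a multilinear function of `n` matrices of size `n`
with `mixedDet (A, …, A) = n! det A`. -/
def mixedDet (A : n → Matrix n n R) : R :=
  ∑ σ : Equiv.Perm n, ∑ τ : Equiv.Perm n,
    ((Equiv.Perm.sign σ : ℤ) : R) * ((Equiv.Perm.sign τ : ℤ) : R) * ∏ k, A k (σ k) (τ k)

theorem mixedDet_eq_sum_det (A : n → Matrix n n R) :
    mixedDet A = ∑ σ : Equiv.Perm n, ((Equiv.Perm.sign σ : ℤ) : R) *
      Matrix.det (Matrix.of fun k => A k (σ k)) := by
  refine Finset.sum_congr rfl fun σ _ => ?_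
  rw [← Matrix.det_transpose, Matrix.det_apply', Finset.mul_sum]
  refine Finset.sum_congr rfl fun τ _ => ?_
  simp [mul_assoc]

theorem mixedDet_const (A : Matrix n n R) :
    mixedDet (fun _ => A) = (Fintype.card n).factorial * A.det := by
  rw [mixedDet_eq_sum_det]
  have : ∀ σ : Equiv.Perm n, ((Equiv.Perm.sign σ : ℤ) : R) *
      Matrix.det (Matrix.of fun k => A (σ k)) = A.det := by
    intro σ
    have h : (Matrix.of fun k => A (σ k)) = A.submatrix σ id := rfl
    rw [h, Matrix.det_permute, ← mul_assoc, ← Int.cast_mul, ← Units.val_mul, Int.units_mul_self]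
    simp
  simp [this, Finset.card_univ, Fintype.card_perm]

theorem mixedDet_comp_perm (π : Equiv.Perm n) (A : n → Matrix n n R) :
    mixedDet (A ∘ π) = mixedDet A := by
  unfold mixedDet
  rw [← Equiv.sum_comp (Equiv.mulRight π)]
  refine Finset.sum_congr rfl fun σ _ => ?_
  rw [← Equiv.sum_comp (Equiv.mulRight π)]
  refine Finset.sum_congr rfl fun τ _ => ?_
  have h1 : ∏ k, (A ∘ π) k (((Equiv.mulRight π) σ) k) (((Equiv.mulRight π) τ) k) =
      ∏ k, A k (σ k) (τ k) := by
    rw [← Equiv.prod_comp π fun k => A k (σ k) (τ k)]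
    simp
  rw [h1]
  congr 1
  have h2 : ((Equiv.Perm.sign π : ℤ) : R) * ((Equiv.Perm.sign π : ℤ) : R) = 1 := by
    rw [← Int.cast_mul, ← Units.val_mul, Int.units_mul_self]
    simp
  simp only [Equiv.coe_mulRight, Equiv.Perm.sign_mul, Units.val_mul, Int.cast_mul]
  linear_combination ((Equiv.Perm.sign σ : ℤ) : R) * ((Equiv.Perm.sign τ : ℤ) : R) * h2

/-- Together with `mixedDet_const` this expands `n! det(∑ c_s B_s)`. It is applied both to the
powers of `U` and to the Toeplitz shifts, and so reduces Laurent polynomial symbols to monomials. -/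
theorem mixedDet_sum_smul {ι : Type*} (F : Finset ι) (c : ι → R) (B : ι → Matrix n n R) :
    mixedDet (fun _ : n => ∑ s ∈ F, c s • B s) =
      ∑ p ∈ Fintype.piFinset fun _ : n => F, (∏ k, c (p k)) * mixedDet fun k => B (p k) := by
  classical
  unfold mixedDet
  simp only [Finset.mul_sum]
  symm
  rw [Finset.sum_comm]
  refine Finset.sum_congr rfl fun σ _ => ?_
  rw [Finset.sum_comm]
  refine Finset.sum_congr rfl fun τ _ => ?_
  symm
  simp only [Matrix.sum_apply, Matrix.smul_apply, smul_eq_mul]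
  rw [Finset.prod_univ_sum, Finset.mul_sum]
  refine Finset.sum_congr rfl fun p _ => ?_
  rw [Finset.prod_mul_distrib]
  ring

/-- `mixedDet` as an additive function of one slot. -/
def mixedDetSlot (A : n → Matrix n n R) (k : n) : Matrix n n R →+ R where
  toFun B := mixedDet (Function.update A k B)
  map_zero' := by
    unfold mixedDet
    refine Finset.sum_eq_zero fun σ _ => Finset.sum_eq_zero fun τ _ => ?_
    rw [Finset.prod_eq_zero (Finset.mem_univ k) (by simp), mul_zero]
  map_add' B C := by
    unfold mixedDet
    rw [← Finset.sum_add_distrib]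
    refine Finset.sum_congr rfl fun σ _ => ?_
    rw [← Finset.sum_add_distrib]
    refine Finset.sum_congr rfl fun τ _ => ?_
    rw [← mul_add, ← Finset.mul_prod_erase _ _ (Finset.mem_univ k),
      ← Finset.mul_prod_erase _ _ (Finset.mem_univ k),
      ← Finset.mul_prod_erase _ _ (Finset.mem_univ k)]
    have h : ∀ D : Matrix n n R, ∏ x ∈ Finset.univ.erase k,
        (Function.update A k D) x (σ x) (τ x) =
        ∏ x ∈ Finset.univ.erase k, A x (σ x) (τ x) := fun D =>
      Finset.prod_congr rfl fun x hx => by rw [Function.update_of_ne (Finset.ne_of_mem_erase hx)]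
    rw [h, h, h]
    simp only [Function.update_self, Matrix.add_apply]
    ring

@[simp] theorem mixedDetSlot_apply (A : n → Matrix n n R) (k : n) (B : Matrix n n R) :
    mixedDetSlot A k B = mixedDet (Function.update A k B) := rfl

theorem mixedDet_update_smul (A : n → Matrix n n R) (k : n) (c : R) (B : Matrix n n R) :
    mixedDet (Function.update A k (c • B)) = c * mixedDet (Function.update A k B) := by
  unfold mixedDet
  simp only [Finset.mul_sum]
  refine Finset.sum_congr rfl fun σ _ => Finset.sum_congr rfl fun τ _ => ?_
  rw [← Finset.mul_prod_erase _ _ (Finset.mem_univ k),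
    ← Finset.mul_prod_erase _ _ (Finset.mem_univ k)]
  have h : ∀ D : Matrix n n R, ∏ x ∈ Finset.univ.erase k,
      (Function.update A k D) x (σ x) (τ x) =
      ∏ x ∈ Finset.univ.erase k, A x (σ x) (τ x) := fun D =>
    Finset.prod_congr rfl fun x hx => by rw [Function.update_of_ne (Finset.ne_of_mem_erase hx)]
  rw [h, h]
  simp only [Function.update_self, Matrix.smul_apply, smul_eq_mul]
  ring

/-- By Cramer's rule the `i`-th summand is the diagonal entry `(C B adj(C))_{ii}`. The trace is
cyclic and `adj(C) C = det C`. -/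
theorem sum_det_updateRow_vecMul (C B : Matrix n n R) :
    ∑ i, (C.updateRow i (Matrix.vecMul (C i) B)).det = B.trace * C.det := by
  have h : ∀ i, (C.updateRow i (Matrix.vecMul (C i) B)).det = (C * B * C.adjugate) i i := by
    intro i
    rw [← Matrix.cramer_transpose_apply, Matrix.cramer_eq_adjugate_mulVec,
      ← Matrix.adjugate_transpose, Matrix.mulVec_transpose, Matrix.mul_apply_eq_vecMul,
      Matrix.mul_apply_eq_vecMul]
  simp only [h]
  change (C * B * C.adjugate).trace = _
  rw [Matrix.trace_mul_comm, ← Matrix.mul_assoc, Matrix.adjugate_mul]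
  simp [mul_comm]

/-- Right multiplication acts on `mixedDet` as a derivation, through the trace. -/
theorem sum_mixedDet_update_mul (A : n → Matrix n n R) (B : Matrix n n R) :
    ∑ i, mixedDet (Function.update A i (A i * B)) = B.trace * mixedDet A := by
  simp only [mixedDet_eq_sum_det]
  rw [Finset.sum_comm, Finset.mul_sum]
  refine Finset.sum_congr rfl fun σ _ => ?_
  rw [mul_left_comm, ← sum_det_updateRow_vecMul, Finset.mul_sum]
  refine Finset.sum_congr rfl fun i _ => ?_
  congr 2
  ext k j
  by_cases h : k = i
  · subst h
    simp [Matrix.mul_apply, Matrix.vecMul, dotProduct]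
  · simp [h]

/-- Contracting two slots with the flip of the two tensor factors changes the sign. -/
theorem sum_mixedDet_update_single (A : n → Matrix n n R) {k i : n} (hik : i ≠ k)
    (X Y Z : Matrix n n R) :
    ∑ a, ∑ b, mixedDet (Function.update (Function.update A k (Matrix.single b a 1 * X)) i
      (Y * Matrix.single a b 1 * Z)) =
    - mixedDet (Function.update (Function.update A k Z) i (Y * X)) := by
  have hk : k ∈ Finset.univ.erase i := by simp [hik.symm]
  have hprod : ∀ (B C : Matrix n n R) (σ τ : Equiv.Perm n),
      ∏ x, (Function.update (Function.update A k B) i C) x (σ x) (τ x) =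
      C (σ i) (τ i) * (B (σ k) (τ k) *
        ∏ x ∈ (Finset.univ.erase i).erase k, A x (σ x) (τ x)) := by
    intro B C σ τ
    rw [← Finset.mul_prod_erase _ _ (Finset.mem_univ i), ← Finset.mul_prod_erase _ _ hk]
    simp only [Function.update_self, Function.update_of_ne hik.symm]
    congr 2
    refine Finset.prod_congr rfl fun x hx => ?_
    simp only [Finset.mem_erase, Finset.mem_univ, and_true] at hx
    rw [Function.update_of_ne hx.2, Function.update_of_ne hx.1]
  -- `∑ E_{ab} ⊗ E_{ba}` is the flip of the two tensor factors: it exchanges the column indices `τ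
  -- i` and `τ k`.
  have hsum : ∀ σ τ : Equiv.Perm n, ∑ a, ∑ b, (Y * Matrix.single a b (1 : R) * Z : Matrix n n R) (σ i) (τ i) *
      (Matrix.single b a (1 : R) * X : Matrix n n R) (σ k) (τ k) = (Y * X) (σ i) (τ k) * Z (σ k) (τ i) := by
    intro σ τ
    have h1 : ∀ a b, (Y * Matrix.single a b (1 : R) * Z : Matrix n n R) (σ i) (τ i) = Y (σ i) a * Z b (τ i) := by
      intro a b
      rw [Matrix.mul_assoc, Matrix.mul_apply, Finset.sum_eq_single a]
      · simp
      · intro c _ hc; simp [hc]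
      · simp
    have h2 : ∀ a b, (Matrix.single b a (1 : R) * X : Matrix n n R) (σ k) (τ k) =
        if b = σ k then X a (τ k) else 0 := by
      intro a b
      split_ifs with h
      · subst h; simp
      · rw [Matrix.single_mul_apply_of_ne]; exact fun h' => h h'.symm
    simp only [h1, h2, mul_ite, mul_zero, Finset.sum_ite_eq', Finset.mem_univ, if_true]
    rw [Matrix.mul_apply, Finset.sum_mul]
    exact Finset.sum_congr rfl fun a _ => by ring
  unfold mixedDet
  simp only [hprod]
  have hL : ∑ a, ∑ b, ∑ σ : Equiv.Perm n, ∑ τ : Equiv.Perm n,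
      ((Equiv.Perm.sign σ : ℤ) : R) * ((Equiv.Perm.sign τ : ℤ) : R) *
      ((Y * Matrix.single a b (1 : R) * Z : Matrix n n R) (σ i) (τ i) *
        ((Matrix.single b a (1 : R) * X : Matrix n n R) (σ k) (τ k) *
        ∏ x ∈ (Finset.univ.erase i).erase k, A x (σ x) (τ x))) =
      ∑ σ : Equiv.Perm n, ∑ τ : Equiv.Perm n,
      ((Equiv.Perm.sign σ : ℤ) : R) * ((Equiv.Perm.sign τ : ℤ) : R) *
      ((Y * X) (σ i) (τ k) * Z (σ k) (τ i) *
        ∏ x ∈ (Finset.univ.erase i).erase k, A x (σ x) (τ x)) := by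
    simp only [← hsum, Finset.sum_mul, Finset.mul_sum]
    rw [Finset.sum_congr rfl fun a _ => Finset.sum_comm, Finset.sum_comm]
    refine Finset.sum_congr rfl fun σ _ => ?_
    rw [Finset.sum_congr rfl fun a _ => Finset.sum_comm, Finset.sum_comm]
    refine Finset.sum_congr rfl fun τ _ => ?_
    refine Finset.sum_congr rfl fun a _ => Finset.sum_congr rfl fun b _ => ?_
    ring
  rw [hL, ← Finset.sum_neg_distrib]
  refine Finset.sum_congr rfl fun σ _ => ?_
  -- Composing `τ` with the transposition of `i` and `k` restores the column indices and costs the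
  -- sign.
  rw [← Equiv.sum_comp (Equiv.mulRight (Equiv.swap i k)), ← Finset.sum_neg_distrib]
  refine Finset.sum_congr rfl fun τ _ => ?_
  have h3 : ∏ x ∈ (Finset.univ.erase i).erase k, A x (σ x) (τ (Equiv.swap i k x)) =
      ∏ x ∈ (Finset.univ.erase i).erase k, A x (σ x) (τ x) := by
    refine Finset.prod_congr rfl fun x hx => ?_
    simp only [Finset.mem_erase, Finset.mem_univ, and_true] at hx
    rw [Equiv.swap_apply_of_ne_of_ne hx.2 hx.1]
  simp only [Equiv.coe_mulRight, h3, Equiv.Perm.sign_mul, Equiv.Perm.sign_swap hik,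
    Equiv.Perm.mul_apply, Equiv.swap_apply_left, Equiv.swap_apply_right]
  push_cast
  ring

end mixedDet

/-! ### Derivatives of powers of a unitary matrix along left translations -/

section LaurentCalculus

variable {N : ℕ}

/-- A curve of matrices has at `0` the given entrywise derivative. -/
def HasEntryDeriv (B : ℝ → Matrix (Fin N) (Fin N) ℂ) (B' : Matrix (Fin N) (Fin N) ℂ) : Prop :=
  ∀ i j, HasDerivAt (fun θ => B θ i j) (B' i j) 0

theorem HasEntryDeriv.mul {B C : ℝ → Matrix (Fin N) (Fin N) ℂ} {B' C' : Matrix (Fin N) (Fin N) ℂ}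
    (hB : HasEntryDeriv B B') (hC : HasEntryDeriv C C') :
    HasEntryDeriv (fun θ => B θ * C θ) (B' * C 0 + B 0 * C') := by
  intro i j
  simp only [Matrix.mul_apply, Matrix.add_apply, ← Finset.sum_add_distrib]
  exact HasDerivAt.fun_sum fun m _ => (hB i m).mul (hC m j)

theorem hasEntryDeriv_const (B : Matrix (Fin N) (Fin N) ℂ) : HasEntryDeriv (fun _ => B) 0 :=
  fun _ _ => hasDerivAt_const _ _

theorem HasEntryDeriv.mixedDet {B : Fin N → ℝ → Matrix (Fin N) (Fin N) ℂ}
    {B' : Fin N → Matrix (Fin N) (Fin N) ℂ} (hB : ∀ k, HasEntryDeriv (B k) (B' k)) :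
    HasDerivAt (fun θ => mixedDet fun k => B k θ)
      (∑ i, mixedDet (Function.update (fun k => B k 0) i (B' i))) 0 := by
  unfold _root_.mixedDet
  rw [Finset.sum_comm]
  refine HasDerivAt.fun_sum fun σ _ => ?_
  rw [Finset.sum_comm]
  refine HasDerivAt.fun_sum fun τ _ => ?_
  rw [← Finset.mul_sum]
  refine HasDerivAt.const_mul _ ?_
  have h := HasDerivAt.fun_finsetProd (u := Finset.univ) fun k _ => hB k (σ k) (τ k)
  refine h.congr_deriv (Finset.sum_congr rfl fun i _ => ?_)
  rw [← Finset.mul_prod_erase _ _ (Finset.mem_univ i), smul_eq_mul, mul_comm]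
  simp only [Function.update_self]
  congr 1
  refine Finset.prod_congr rfl fun x hx => ?_
  rw [Function.update_of_ne (Finset.ne_of_mem_erase hx)]

/-- The unitary `1 + (e^{iθ} - 1) p` attached to an orthogonal projection `p`. -/
noncomputable def phaseRotation (p : Matrix (Fin N) (Fin N) ℂ) (hp : p * p = p) (hs : star p = p)
    (θ : ℝ) : Matrix.unitaryGroup (Fin N) ℂ :=
  ⟨1 + (Complex.exp (θ * Complex.I) - 1) • p, by
    rw [Matrix.mem_unitaryGroup_iff, star_add, star_one, star_smul, hs, add_mul, mul_add, mul_add,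
      smul_mul_smul_comm, hp, one_mul, one_mul, mul_one]
    have h : Complex.exp (θ * Complex.I) * star (Complex.exp (θ * Complex.I)) = 1 := by
      have := Complex.mul_conj (Complex.exp (θ * Complex.I))
      rw [Complex.normSq_eq_norm_sq, Complex.norm_exp_ofReal_mul_I] at this
      simpa using this
    have h2 : star (Complex.exp (θ * Complex.I) - 1) + (Complex.exp (θ * Complex.I) - 1) +
        (Complex.exp (θ * Complex.I) - 1) * star (Complex.exp (θ * Complex.I) - 1) = 0 := by
      rw [star_sub, star_one]
      linear_combination h
    rw [add_assoc, add_eq_left, ← add_assoc, ← add_smul, ← add_smul, h2, zero_smul]⟩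

variable (p : Matrix (Fin N) (Fin N) ℂ) (hp : p * p = p) (hs : star p = p)

theorem coe_phaseRotation (θ : ℝ) : (phaseRotation p hp hs θ : Matrix (Fin N) (Fin N) ℂ) =
    1 + (Complex.exp (θ * Complex.I) - 1) • p := rfl

theorem phaseRotation_zero : phaseRotation p hp hs 0 = 1 :=
  Subtype.ext (by simp [coe_phaseRotation])

theorem phaseRotation_add (θ φ : ℝ) :
    phaseRotation p hp hs (θ + φ) = phaseRotation p hp hs θ * phaseRotation p hp hs φ := by
  refine Subtype.ext ?_
  simp only [Submonoid.coe_mul, coe_phaseRotation]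
  rw [add_mul, mul_add, mul_add, smul_mul_smul_comm, hp, one_mul, one_mul, mul_one, add_assoc,
    ← add_assoc (_ • p), ← add_smul, ← add_smul]
  congr 2
  push_cast
  rw [add_mul, Complex.exp_add]
  ring

theorem phaseRotation_neg (θ : ℝ) :
    phaseRotation p hp hs (-θ) = (phaseRotation p hp hs θ)⁻¹ := by
  rw [eq_inv_iff_mul_eq_one, ← phaseRotation_add, neg_add_cancel, phaseRotation_zero]

theorem hasEntryDeriv_phaseRotation : HasEntryDeriv
    (fun θ => (phaseRotation p hp hs θ : Matrix (Fin N) (Fin N) ℂ)) (Complex.I • p) := by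
  intro i j
  have h1 : HasDerivAt (fun θ : ℝ => Complex.exp (θ * Complex.I)) Complex.I 0 := by
    have := ((hasDerivAt_id (0 : ℝ)).ofReal_comp.mul_const Complex.I).cexp
    simpa using this
  have h2 := ((h1.sub_const 1).mul_const (p i j)).const_add ((1 : Matrix (Fin N) (Fin N) ℂ) i j)
  simpa [coe_phaseRotation] using h2

theorem hasEntryDeriv_phaseRotation_neg : HasEntryDeriv
    (fun θ => ((phaseRotation p hp hs θ)⁻¹ : Matrix.unitaryGroup (Fin N) ℂ).1)
    (-(Complex.I • p)) := by
  intro i j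
  have h := (hasEntryDeriv_phaseRotation p hp hs i j)
  rw [← neg_zero] at h
  have h2 := h.scomp (0 : ℝ) (hasDerivAt_neg (0 : ℝ))
  simpa [Function.comp_def, phaseRotation_neg] using h2

/-- The derivative of `U ↦ U^s` along the left translation by the tangent vector `X`. -/
noncomputable def zpowDeriv (U : Matrix.unitaryGroup (Fin N) ℂ) (X : Matrix (Fin N) (Fin N) ℂ)
    (s : ℤ) : Matrix (Fin N) (Fin N) ℂ :=
  zsum (fun l => (U ^ (s - l)).1 * X * (U ^ l).1) s

theorem mul_zsum_mul (A B : Matrix (Fin N) (Fin N) ℂ) (g : ℤ → Matrix (Fin N) (Fin N) ℂ) (s : ℤ) :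
    A * zsum g s * B = zsum (fun l => A * g l * B) s := by
  simp [zsum, mul_sub, sub_mul, Finset.mul_sum, Finset.sum_mul]

/-- Leibniz rule for `U^{s+1} = U · U^s`: the new summand `l = s + 1` is the term where the first
factor is differentiated. With its companion `zpowDeriv_sub_one` it drives the induction over `ℤ` in
`hasEntryDeriv_zpow`. -/
theorem zpowDeriv_add_one (U : Matrix.unitaryGroup (Fin N) ℂ) (X : Matrix (Fin N) (Fin N) ℂ)
    (s : ℤ) : zpowDeriv U X (s + 1) = U.1 * zpowDeriv U X s + X * (U ^ (s + 1)).1 := by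
  have h := mul_zsum_mul U.1 1 (fun l => (U ^ (s - l)).1 * X * (U ^ l).1) s
  rw [mul_one] at h
  rw [zpowDeriv, zsum_add_one, zpowDeriv, h, sub_self, zpow_zero]
  congr 1
  · congr 1
    ext1 l
    rw [mul_one, ← mul_assoc, ← mul_assoc, ← Submonoid.coe_mul, ← zpow_one_add]
    congr 5
    ring
  · simp

theorem zpowDeriv_sub_one (U : Matrix.unitaryGroup (Fin N) ℂ) (X : Matrix (Fin N) (Fin N) ℂ)
    (s : ℤ) : zpowDeriv U X (s - 1) =
      (U⁻¹).1 * zpowDeriv U X s - (U⁻¹).1 * X * (U ^ s).1 := by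
  have h := zpowDeriv_add_one U X (s - 1)
  rw [sub_add_cancel] at h
  rw [h, mul_add, ← mul_assoc, ← Submonoid.coe_mul, inv_mul_cancel]
  simp [mul_assoc]

theorem hasEntryDeriv_zpow (U : Matrix.unitaryGroup (Fin N) ℂ) (s : ℤ) : HasEntryDeriv
    (fun θ => ((phaseRotation p hp hs θ * U) ^ s : Matrix.unitaryGroup (Fin N) ℂ).1)
    (zpowDeriv U (Complex.I • p) s) := by
  induction s using Int.induction_on with
  | zero => simpa [zpowDeriv] using hasEntryDeriv_const (1 : Matrix (Fin N) (Fin N) ℂ)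
  | succ n ih =>
    have h1 : HasEntryDeriv (fun θ => (phaseRotation p hp hs θ * U).1) (Complex.I • p * U.1) := by
      simpa using (hasEntryDeriv_phaseRotation p hp hs).mul (hasEntryDeriv_const U.1)
    have h2 := h1.mul ih
    rw [zpowDeriv_add_one]
    simp only [phaseRotation_zero, one_mul, ← Submonoid.coe_mul, ← zpow_one_add] at h2
    rw [mul_assoc, ← Submonoid.coe_mul, ← zpow_one_add, add_comm (Complex.I • p * _)] at h2
    simpa only [add_comm (1 : ℤ)] using h2
  | pred n ih =>
    have h1 : HasEntryDeriv (fun θ => ((phaseRotation p hp hs θ * U)⁻¹).1)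
        (-((U⁻¹).1 * (Complex.I • p))) := by
      simpa only [mul_inv_rev, Submonoid.coe_mul, zero_mul, zero_add, mul_neg] using
        (hasEntryDeriv_const (U⁻¹).1).mul (hasEntryDeriv_phaseRotation_neg p hp hs)
    have h2 := h1.mul ih
    rw [zpowDeriv_sub_one]
    simp only [phaseRotation_zero, one_mul, ← Submonoid.coe_mul, ← zpow_neg_one, ← zpow_add] at h2
    simp only [neg_mul, neg_add_eq_sub] at h2
    simpa only [zpow_neg_one] using h2

end LaurentCalculus

/-! ### Loop equations for Haar measure -/

section HaarLoop

variable {N : ℕ}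

instance haarU_isMulLeftInvariant (N : ℕ) : (haarU N).IsMulLeftInvariant := by
  unfold haarU; infer_instance

theorem Continuous.integrable_haarU {F : Matrix.unitaryGroup (Fin N) ℂ → ℂ} (hF : Continuous F) :
    Integrable F (haarU N) :=
  hF.integrable_of_hasCompactSupport (HasCompactSupport.of_compactSpace F)

/-- The integral of a derivative along left translations vanishes. -/
theorem integral_leftDeriv_eq_zero (p : Matrix (Fin N) (Fin N) ℂ) (hp : p * p = p)
    (hs : star p = p) {F F' : Matrix.unitaryGroup (Fin N) ℂ → ℂ} (hF : Continuous F)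
    (hF' : Continuous F')
    (h : ∀ U, HasDerivAt (fun θ => F (phaseRotation p hp hs θ * U)) (F' U) 0) :
    ∫ U, F' U ∂haarU N = 0 := by
  obtain ⟨C, hC⟩ := (isCompact_univ (X := Matrix.unitaryGroup (Fin N) ℂ)).exists_bound_of_continuousOn
    hF'.continuousOn
  -- The group law of `phaseRotation` moves the derivative at `0` to any other parameter.
  have hd : ∀ U, ∀ θ : ℝ, HasDerivAt (fun φ => F (phaseRotation p hp hs φ * U))
      (F' (phaseRotation p hp hs θ * U)) θ := by
    intro U θ
    have h1 := h (phaseRotation p hp hs θ * U)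
    rw [← sub_self θ] at h1
    have h2 := h1.comp_sub_const θ θ
    simpa [← mul_assoc, ← phaseRotation_add] using h2
  have key := hasDerivAt_integral_of_dominated_loc_of_deriv_le (μ := haarU N) (𝕜 := ℝ)
    (F := fun θ U => F (phaseRotation p hp hs θ * U))
    (F' := fun θ U => F' (phaseRotation p hp hs θ * U)) (x₀ := 0) (s := Set.univ)
    (bound := fun _ => C) univ_mem
    (Eventually.of_forall fun θ =>
      (hF.comp (continuous_const_mul _)).integrable_haarU.aestronglyMeasurable)
    (hF.comp (continuous_const_mul _)).integrable_haarU
    (hF'.comp (continuous_const_mul _)).integrable_haarU.aestronglyMeasurable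
    (Eventually.of_forall fun U θ _ => hC _ (Set.mem_univ _))
    (integrable_const C)
    (Eventually.of_forall fun U θ _ => hd U θ)
  have h1 := key.2
  -- By left invariance the differentiated integral does not depend on the parameter.
  simp only [integral_mul_left_eq_self] at h1
  exact h1.unique (hasDerivAt_const _ _)

theorem continuous_mixedDet {X : Type*} [TopologicalSpace X] {A : Fin N → X → Matrix (Fin N) (Fin N) ℂ}
    (hA : ∀ k, Continuous (A k)) : Continuous fun x => mixedDet fun k => A k x := by
  unfold mixedDet
  refine continuous_finsetSum _ fun σ _ => continuous_finsetSum _ fun τ _ => ?_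
  exact continuous_const.mul (continuous_finsetProd _ fun k _ => (hA k).matrix_elem _ _)

theorem continuous_coe_zpow (s : ℤ) :
    Continuous fun U : Matrix.unitaryGroup (Fin N) ℂ => (U ^ s).1 :=
  continuous_subtype_val.comp (continuous_zpow s)

theorem continuous_zpowDeriv (X : Matrix (Fin N) (Fin N) ℂ) (s : ℤ) :
    Continuous fun U : Matrix.unitaryGroup (Fin N) ℂ => zpowDeriv U X s := by
  unfold zpowDeriv zsum
  have h : ∀ l, Continuous fun U : Matrix.unitaryGroup (Fin N) ℂ =>
      (U ^ (s - l)).1 * X * (U ^ l).1 := fun l =>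
    ((continuous_coe_zpow _).matrix_mul continuous_const).matrix_mul (continuous_coe_zpow _)
  exact (continuous_finsetSum _ fun l _ => h l).sub (continuous_finsetSum _ fun l _ => h l)

theorem zpowDeriv_add (U : Matrix.unitaryGroup (Fin N) ℂ) (X Y : Matrix (Fin N) (Fin N) ℂ)
    (s : ℤ) : zpowDeriv U (X + Y) s = zpowDeriv U X s + zpowDeriv U Y s := by
  simp only [zpowDeriv, ← zsum_add_distrib, mul_add, add_mul]

theorem zpowDeriv_smul (U : Matrix.unitaryGroup (Fin N) ℂ) (c : ℂ) (X : Matrix (Fin N) (Fin N) ℂ)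
    (s : ℤ) : zpowDeriv U (c • X) s = c • zpowDeriv U X s := by
  simp only [zpowDeriv, zsum, smul_sub, Finset.smul_sum, Matrix.mul_smul, Matrix.smul_mul]

/-- The derivative along `X` of `U ↦ mixedDet (U^{s_1}, …, Y U^{s_k}, …, U^{s_N})`. -/
noncomputable def loopDeriv (s : Fin N → ℤ) (k : Fin N) (Y : Matrix (Fin N) (Fin N) ℂ)
    (U : Matrix.unitaryGroup (Fin N) ℂ) (X : Matrix (Fin N) (Fin N) ℂ) : ℂ :=
  ∑ i, mixedDet (Function.update (Function.update (fun j => (U ^ s j).1) k (Y * (U ^ s k).1)) i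
    (if i = k then Y * zpowDeriv U X (s i) else zpowDeriv U X (s i)))

theorem continuous_loopDeriv (s : Fin N → ℤ) (k : Fin N) (X Y : Matrix (Fin N) (Fin N) ℂ) :
    Continuous fun U : Matrix.unitaryGroup (Fin N) ℂ => loopDeriv s k Y U X := by
  unfold loopDeriv
  refine continuous_finsetSum _ fun i _ => continuous_mixedDet fun j => ?_
  by_cases hj : j = i
  · subst hj
    simp only [Function.update_self]
    split_ifs
    · exact continuous_const.matrix_mul (continuous_zpowDeriv X _)
    · exact continuous_zpowDeriv X _
  · simp only [Function.update_of_ne hj]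
    by_cases hk : j = k
    · subst hk
      simp only [Function.update_self]
      exact continuous_const.matrix_mul (continuous_coe_zpow _)
    · simp only [Function.update_of_ne hk]
      exact continuous_coe_zpow _

theorem integral_loopDeriv_projection (s : Fin N → ℤ) (k : Fin N) (Y p : Matrix (Fin N) (Fin N) ℂ)
    (hp : p * p = p) (hs : star p = p) :
    ∫ U, loopDeriv s k Y U (Complex.I • p) ∂haarU N = 0 := by
  refine integral_leftDeriv_eq_zero p hp hs (F := fun U =>
    mixedDet fun j => if j = k then Y * (U ^ s j).1 else (U ^ s j).1) ?_
    (continuous_loopDeriv _ _ _ _) ?_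
  · refine continuous_mixedDet fun j => ?_
    split_ifs
    · exact continuous_const.matrix_mul (continuous_coe_zpow _)
    · exact continuous_coe_zpow _
  · intro U
    have h := HasEntryDeriv.mixedDet
      (B := fun j θ => if j = k then Y * ((phaseRotation p hp hs θ * U) ^ s j).1
        else ((phaseRotation p hp hs θ * U) ^ s j).1)
      (B' := fun j => if j = k then Y * zpowDeriv U (Complex.I • p) (s j)
        else zpowDeriv U (Complex.I • p) (s j)) ?_
    · refine h.congr_deriv (Finset.sum_congr rfl fun i _ => ?_)
      congr 2
      ext1 j
      by_cases hj : j = k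
      · subst hj; simp [phaseRotation_zero]
      · simp [hj, phaseRotation_zero]
    · intro j
      by_cases hj : j = k
      · simpa [hj] using (hasEntryDeriv_const Y).mul (hasEntryDeriv_zpow p hp hs U (s k))
      · simpa [hj] using hasEntryDeriv_zpow p hp hs U (s j)

/-- A linear form which vanishes on the orthogonal projections vanishes. -/
theorem linearMap_single_eq_zero (Φ : Matrix (Fin N) (Fin N) ℂ →ₗ[ℂ] ℂ)
    (h : ∀ p, p * p = p → star p = p → Φ p = 0) (a b : Fin N) : Φ (Matrix.single a b 1) = 0 := by
  have hdiag : ∀ a, Φ (Matrix.single a a 1) = 0 := fun a =>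
    h _ (by simp) (by simp [Matrix.star_eq_conjTranspose])
  by_cases hab : a = b
  · subst hab; exact hdiag a
  -- For `|c| = 1` this is the projection onto the line spanned by `e_a + c̄ e_b`.
  have hp : ∀ c : ℂ, c * star c = 1 → Φ ((1 / 2 : ℂ) • (Matrix.single a a 1 + Matrix.single b b 1 +
      Matrix.single a b c + Matrix.single b a (star c))) = 0 := by
    intro c hc
    have hc' : star c * c = 1 := by rw [mul_comm, hc]
    refine h _ ?_ ?_
    · rw [smul_mul_smul_comm]
      simp only [add_mul, mul_add, Matrix.single_mul_single_same, mul_one, one_mul, hc, hc',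
        Matrix.single_mul_single_of_ne _ _ _ _ hab, Matrix.single_mul_single_of_ne _ _ _ _ (Ne.symm hab)]
      ext i j
      simp only [Matrix.smul_apply, Matrix.add_apply, smul_eq_mul, Matrix.zero_apply]
      ring
    · simp only [Matrix.star_eq_conjTranspose, Matrix.conjTranspose_smul, Matrix.conjTranspose_add,
        Matrix.conjTranspose_single, star_star, star_one]
      ext i j
      simp only [Matrix.smul_apply, Matrix.add_apply, smul_eq_mul]
      simp
      ring
  -- Polarisation: `c = 1` gives `E_{ab} + E_{ba}`, and `i` times the case `c = -i` gives `E_{ab} -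
  -- E_{ba}`. The last term removes the diagonal parts.
  have e : Matrix.single a b (1 : ℂ) =
      (1 / 2 : ℂ) • (Matrix.single a a 1 + Matrix.single b b 1 + Matrix.single a b (1 : ℂ) +
        Matrix.single b a (star (1 : ℂ))) +
      Complex.I • ((1 / 2 : ℂ) • (Matrix.single a a 1 + Matrix.single b b 1 +
        Matrix.single a b (-Complex.I) + Matrix.single b a (star (-Complex.I)))) +
      (-(1 + Complex.I) / 2) • (Matrix.single a a 1 + Matrix.single b b 1) := by
    ext i j
    simp only [Matrix.smul_apply, Matrix.add_apply, smul_eq_mul, Matrix.single_apply]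
    split_ifs <;> simp <;> ring_nf <;> simp <;> ring
  rw [e, map_add, map_add, map_smul _ Complex.I, hp 1 (by simp), hp (-Complex.I) (by simp),
    map_smul, map_add, hdiag, hdiag]
  simp

/-- Matrix units are not tangent to the unitary group, but the integral is complex linear in the
direction `X`, so its vanishing on the directions `i p` extends to all matrices. -/
theorem integral_loopDeriv_single (s : Fin N → ℤ) (k : Fin N) (Y : Matrix (Fin N) (Fin N) ℂ)
    (a b : Fin N) : ∫ U, loopDeriv s k Y U (Matrix.single a b 1) ∂haarU N = 0 := by
  have hadd : ∀ (U : Matrix.unitaryGroup (Fin N) ℂ) X Z,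
      loopDeriv s k Y U (X + Z) = loopDeriv s k Y U X + loopDeriv s k Y U Z := by
    intro U X Z
    simp only [loopDeriv, ← Finset.sum_add_distrib, zpowDeriv_add, mul_add]
    refine Finset.sum_congr rfl fun i _ => ?_
    simp only [← mixedDetSlot_apply]
    split_ifs <;> exact map_add _ _ _
  have hsmul : ∀ (U : Matrix.unitaryGroup (Fin N) ℂ) (c : ℂ) X,
      loopDeriv s k Y U (c • X) = c * loopDeriv s k Y U X := by
    intro U c X
    simp only [loopDeriv, Finset.mul_sum, zpowDeriv_smul, Matrix.mul_smul]
    refine Finset.sum_congr rfl fun i _ => ?_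
    split_ifs <;> exact mixedDet_update_smul _ _ _ _
  let Φ : Matrix (Fin N) (Fin N) ℂ →ₗ[ℂ] ℂ :=
    { toFun := fun X => ∫ U, loopDeriv s k Y U X ∂haarU N
      map_add' := fun X Z => by
        simp only [hadd]
        exact integral_add (continuous_loopDeriv _ _ _ _).integrable_haarU
          (continuous_loopDeriv _ _ _ _).integrable_haarU
      map_smul' := fun c X => by
        simp only [hsmul]
        exact integral_const_mul _ _ }
  refine linearMap_single_eq_zero Φ (fun p hp hs => ?_) a b
  have h := integral_loopDeriv_projection s k Y p hp hs
  simp only [hsmul, integral_const_mul] at h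
  exact (mul_eq_zero.1 h).resolve_left Complex.I_ne_zero

/-- `mixedDet (U^{s_1}, …, U^{s_N})`, which is `N!` times the monomial symmetric average
of the eigenvalues. -/
noncomputable def mixedPow (U : Matrix.unitaryGroup (Fin N) ℂ) (s : Fin N → ℤ) : ℂ :=
  mixedDet fun j => (U ^ s j).1

theorem continuous_mixedPow (s : Fin N → ℤ) :
    Continuous fun U : Matrix.unitaryGroup (Fin N) ℂ => mixedPow U s :=
  continuous_mixedDet fun _ => continuous_coe_zpow _

theorem mixedPow_update_update (U : Matrix.unitaryGroup (Fin N) ℂ) (s : Fin N → ℤ) (k i : Fin N)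
    (l r : ℤ) : mixedPow U (Function.update (Function.update s k l) i r) =
      mixedDet (Function.update (Function.update (fun j => (U ^ s j).1) k (U ^ l).1) i (U ^ r).1) := by
  unfold mixedPow
  congr 1
  ext1 j
  by_cases h : j = i
  · subst h; simp
  · by_cases h' : j = k
    · subst h'; simp [h]
    · simp [h, h']

/-- This contraction produces the traces `tr U^{s_k - l}` in the `k`-th slot of the loop equation.
-/
theorem sum_single_mul_single (B : Matrix (Fin N) (Fin N) ℂ) :
    ∑ a, ∑ b, Matrix.single b a (1 : ℂ) * B * Matrix.single a b 1 = B.trace • 1 := by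
  have h : ∀ a b, Matrix.single b a (1 : ℂ) * B * Matrix.single a b 1 =
      Matrix.single b b (B a a) := by
    intro a b
    rw [Matrix.single_mul_mul_single, one_mul, mul_one]
  rw [Finset.sum_congr rfl fun a _ => Finset.sum_congr rfl fun b _ => h a b]
  ext i j
  simp only [Matrix.sum_apply, Matrix.single_apply, Matrix.smul_apply, Matrix.one_apply,
    smul_eq_mul, Matrix.trace, Matrix.diag_apply, Finset.sum_mul]
  refine Finset.sum_congr rfl fun a _ => ?_
  rw [Finset.sum_eq_single i (fun b _ hb => if_neg fun h => hb h.1) (by simp)]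
  simp

/-- Contraction within the slot `k` gives `∑_l tr(U^{s_k - l}) U^l`. By `sum_mixedDet_update_mul`
the trace distributes the factor `U^{s_k - l}` over all slots. In slot `k` it restores `U^{s_k}`,
which accounts for `s_k` copies of `mixedPow U s`. In slot `i` it yields the exponent `s_k + s_i -
l`. -/
theorem sum_loopDeriv_self (s : Fin N → ℤ) (k : Fin N) (U : Matrix.unitaryGroup (Fin N) ℂ) :
    ∑ a, ∑ b, mixedDet (Function.update (Function.update (fun j => (U ^ s j).1) k
      (Matrix.single b a 1 * (U ^ s k).1)) k
      (Matrix.single b a 1 * zpowDeriv U (Matrix.single a b 1) (s k))) =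
    (s k : ℂ) * mixedPow U s + ∑ i ∈ Finset.univ.erase k,
      zsum (fun l => mixedPow U (Function.update (Function.update s k l) i (s k + s i - l)))
        (s k) := by
  simp only [Function.update_idem, ← mixedDetSlot_apply, ← map_sum]
  have h1 : ∑ a, ∑ b, Matrix.single b a (1 : ℂ) * zpowDeriv U (Matrix.single a b 1) (s k) =
      zsum (fun l => (U ^ (s k - l)).1.trace • (U ^ l).1) (s k) := by
    have h2 : ∀ a b, Matrix.single b a (1 : ℂ) * zpowDeriv U (Matrix.single a b 1) (s k) =
        zsum (fun l => Matrix.single b a (1 : ℂ) * (U ^ (s k - l)).1 * Matrix.single a b 1 *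
          (U ^ l).1) (s k) := by
      intro a b
      have := mul_zsum_mul (Matrix.single b a (1 : ℂ)) 1
        (fun l => (U ^ (s k - l)).1 * Matrix.single a b 1 * (U ^ l).1) (s k)
      simpa only [mul_one, ← mul_assoc, zpowDeriv] using this
    simp only [h2, ← zsum_finset_sum]
    congr 1
    ext1 l
    rw [← one_mul (U ^ l).1, ← Matrix.smul_mul, ← sum_single_mul_single, Finset.sum_mul]
    simp only [Finset.sum_mul, one_mul]
  rw [h1, map_zsum, ← zsum_finset_sum]
  have h3 : (s k : ℂ) * mixedPow U s = zsum (fun _ => mixedPow U s) (s k) := by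
    rw [zsum_const, zsmul_eq_mul]
  rw [h3, ← zsum_add_distrib]
  congr 1
  ext1 l
  rw [mixedDetSlot_apply, mixedDet_update_smul, ← sum_mixedDet_update_mul,
    ← Finset.add_sum_erase _ _ (Finset.mem_univ k)]
  congr 1
  · rw [Function.update_idem, Function.update_self, ← Submonoid.coe_mul, ← zpow_add,
      add_sub_cancel, Function.update_eq_self k (fun j => (U ^ s j).1)]
    rfl
  · refine Finset.sum_congr rfl fun i hi => ?_
    rw [mixedPow_update_update, Function.update_of_ne (Finset.ne_of_mem_erase hi),
      ← Submonoid.coe_mul, ← zpow_add]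
    congr 4
    ring

/-- Here the two matrix units sit in different slots, and the flip rule `sum_mixedDet_update_single`
exchanges the right-hand factors `U^l` and `U^{s_k}`, with a minus sign. -/
theorem sum_loopDeriv_of_ne (s : Fin N → ℤ) {k i : Fin N} (hik : i ≠ k)
    (U : Matrix.unitaryGroup (Fin N) ℂ) :
    ∑ a, ∑ b, mixedDet (Function.update (Function.update (fun j => (U ^ s j).1) k
      (Matrix.single b a 1 * (U ^ s k).1)) i (zpowDeriv U (Matrix.single a b 1) (s i))) =
    - zsum (fun l => mixedPow U (Function.update (Function.update s k l) i (s k + s i - l)))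
        (s i) := by
  simp only [zpowDeriv, ← mixedDetSlot_apply, map_zsum, ← zsum_finset_sum]
  simp only [mixedDetSlot_apply, sum_mixedDet_update_single _ hik, mixedPow_update_update]
  rw [← zsum_neg]
  congr 1
  ext1 l
  rw [← Submonoid.coe_mul, ← zpow_add]
  congr 5
  ring

/-- Pairing the direction `E_{ab}` with the prefactor `E_{ba}` is the contraction after which only
functions of the form `mixedPow` remain. -/
theorem integral_sum_loopDeriv (s : Fin N → ℤ) (k : Fin N) :
    ∫ U, ∑ a, ∑ b, loopDeriv s k (Matrix.single b a 1) U (Matrix.single a b 1) ∂haarU N = 0 := by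
  have hi : ∀ a b : Fin N, Integrable
      (fun U => loopDeriv s k (Matrix.single b a 1) U (Matrix.single a b 1)) (haarU N) :=
    fun a b => (continuous_loopDeriv s k _ _).integrable_haarU
  rw [integral_finsetSum _ fun a _ => integrable_finsetSum _ fun b _ => hi a b]
  refine Finset.sum_eq_zero fun a _ => ?_
  rw [integral_finsetSum _ fun b _ => hi a b]
  exact Finset.sum_eq_zero fun b _ => integral_loopDeriv_single s k _ a b

theorem loop_integrand_eq (s : Fin N → ℤ) (k : Fin N) (U : Matrix.unitaryGroup (Fin N) ℂ) :
    (s k : ℂ) * mixedPow U s + ∑ i ∈ Finset.univ.erase k,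
      (zsum (fun l => mixedPow U (Function.update (Function.update s k l) i (s k + s i - l)))
        (s k) -
      zsum (fun l => mixedPow U (Function.update (Function.update s k l) i (s k + s i - l)))
        (s i)) =
    ∑ a, ∑ b, loopDeriv s k (Matrix.single b a 1) U (Matrix.single a b 1) := by
  rw [Finset.sum_sub_distrib, ← add_sub_assoc, ← sum_loopDeriv_self, sub_eq_add_neg,
    ← Finset.sum_neg_distrib,
    Finset.sum_congr rfl fun i hi => (sum_loopDeriv_of_ne s (Finset.ne_of_mem_erase hi) U).symm]
  have : ∀ a b, loopDeriv s k (Matrix.single b a 1) U (Matrix.single a b 1) =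
      mixedDet (Function.update (Function.update (fun j => (U ^ s j).1) k
        (Matrix.single b a 1 * (U ^ s k).1)) k
        (Matrix.single b a 1 * zpowDeriv U (Matrix.single a b 1) (s k))) +
      ∑ i ∈ Finset.univ.erase k, mixedDet (Function.update (Function.update
        (fun j => (U ^ s j).1) k (Matrix.single b a 1 * (U ^ s k).1)) i
        (zpowDeriv U (Matrix.single a b 1) (s i))) := by
    intro a b
    rw [loopDeriv, ← Finset.add_sum_erase _ _ (Finset.mem_univ k), if_pos rfl]
    congr 1
    refine Finset.sum_congr rfl fun i hi => ?_
    rw [if_neg (Finset.ne_of_mem_erase hi)]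
  have hc : ∀ f : Fin N → Fin N → Fin N → ℂ, ∑ i ∈ Finset.univ.erase k, ∑ a, ∑ b, f i a b =
      ∑ a, ∑ b, ∑ i ∈ Finset.univ.erase k, f i a b := fun f =>
    Finset.sum_comm.trans (Finset.sum_congr rfl fun a _ => Finset.sum_comm)
  rw [hc]
  simp only [this, Finset.sum_add_distrib]

/-- The loop equations for the moments of Haar measure on `U(N)`. -/
theorem haar_loop_equation (s : Fin N → ℤ) (k : Fin N) :
    (s k : ℂ) * ∫ U, mixedPow U s ∂haarU N + ∑ i ∈ Finset.univ.erase k,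
      (zsum (fun l => ∫ U, mixedPow U (Function.update (Function.update s k l) i (s k + s i - l))
        ∂haarU N) (s k) -
       zsum (fun l => ∫ U, mixedPow U (Function.update (Function.update s k l) i (s k + s i - l))
        ∂haarU N) (s i)) = 0 := by
  have hint : ∀ s : Fin N → ℤ, Integrable (fun U => mixedPow U s) (haarU N) :=
    fun s => (continuous_mixedPow s).integrable_haarU
  have hz : ∀ (f : ℤ → Fin N → ℤ) (r : ℤ), zsum (fun l => ∫ U, mixedPow U (f l) ∂haarU N) r =
      ∫ U, zsum (fun l => mixedPow U (f l)) r ∂haarU N := by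
    intro f r
    unfold zsum
    rw [integral_sub (integrable_finsetSum _ fun l _ => hint _)
      (integrable_finsetSum _ fun l _ => hint _), integral_finsetSum _ fun l _ => hint _,
      integral_finsetSum _ fun l _ => hint _]
  have hzi : ∀ (f : ℤ → Fin N → ℤ) (r : ℤ),
      Integrable (fun U => zsum (fun l => mixedPow U (f l)) r) (haarU N) := fun f r =>
    (integrable_finsetSum _ fun l _ => hint _).sub (integrable_finsetSum _ fun l _ => hint _)
  have hzd : ∀ (f : ℤ → Fin N → ℤ) (r q : ℤ), Integrable (fun U =>
      zsum (fun l => mixedPow U (f l)) r - zsum (fun l => mixedPow U (f l)) q) (haarU N) :=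
    fun f r q => (hzi f r).sub (hzi f q)
  simp only [hz]
  rw [← integral_const_mul]
  simp only [← integral_sub (hzi _ _) (hzi _ _)]
  rw [← integral_finsetSum _ fun i _ => hzd _ _ _, ← integral_add
    ((hint s).const_mul _) (integrable_finsetSum _ fun i _ => hzd _ _ _)]
  simp only [loop_integrand_eq]
  exact integral_sum_loopDeriv s k

end HaarLoop

/-! ### Constant terms of Laurent polynomials and the Weyl weight -/

section LaurentPolynomials

variable {N : ℕ}

/-- The monomial `t^v` as a Laurent polynomial in `N` variables. -/
noncomputable def laurentMonomial (v : Fin N → ℤ) : AddMonoidAlgebra ℂ (Fin N → ℤ) :=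
  AddMonoidAlgebra.single v 1

theorem laurentMonomial_mul (v w : Fin N → ℤ) :
    laurentMonomial v * laurentMonomial w = laurentMonomial (v + w) := by
  simp [laurentMonomial, AddMonoidAlgebra.single_mul_single]

theorem laurentMonomial_zero : laurentMonomial (0 : Fin N → ℤ) = 1 := rfl

theorem laurentMonomial_pow (v : Fin N → ℤ) (m : ℕ) :
    laurentMonomial v ^ m = laurentMonomial (m • v) := by
  induction m with
  | zero => simp [laurentMonomial_zero]
  | succ m ih => rw [pow_succ, ih, laurentMonomial_mul, succ_nsmul]

theorem laurentMonomial_prod {ι : Type*} (F : Finset ι) (v : ι → Fin N → ℤ) :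
    ∏ i ∈ F, laurentMonomial (v i) = laurentMonomial (∑ i ∈ F, v i) := by
  classical
  induction F using Finset.induction_on with
  | empty => simp [laurentMonomial_zero]
  | insert a F ha ih => rw [Finset.prod_insert ha, Finset.sum_insert ha, ih, laurentMonomial_mul]

/-- The constant term of a Laurent polynomial. -/
noncomputable def constTerm : AddMonoidAlgebra ℂ (Fin N → ℤ) →+ ℂ :=
  (Finsupp.applyAddHom (0 : Fin N → ℤ)).comp AddMonoidAlgebra.coeffAddEquiv.toAddMonoidHom

theorem constTerm_single (v : Fin N → ℤ) (c : ℂ) :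
    constTerm (AddMonoidAlgebra.single v c) = if v = 0 then c else 0 := by
  change (Finsupp.single v c) 0 = _
  rw [Finsupp.single_apply]

/-- The operator `t_k ∂/∂t_k` on Laurent polynomials. -/
noncomputable def eulerOp (k : Fin N) :
    AddMonoidAlgebra ℂ (Fin N → ℤ) →+ AddMonoidAlgebra ℂ (Fin N → ℤ) :=
  (Finsupp.liftAddHom fun v : Fin N → ℤ =>
    (AddMonoidAlgebra.singleAddHom v).comp (AddMonoidHom.mulLeft (v k : ℂ))).comp
      AddMonoidAlgebra.coeffAddEquiv.toAddMonoidHom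

theorem eulerOp_single (k : Fin N) (v : Fin N → ℤ) (c : ℂ) :
    eulerOp k (AddMonoidAlgebra.single v c) = AddMonoidAlgebra.single v ((v k : ℂ) * c) := by
  change (Finsupp.liftAddHom fun v : Fin N → ℤ =>
    (AddMonoidAlgebra.singleAddHom v).comp (AddMonoidHom.mulLeft (v k : ℂ))) (Finsupp.single v c) = _
  rw [Finsupp.liftAddHom_apply_single]
  rfl

theorem eulerOp_monomial (k : Fin N) (v : Fin N → ℤ) :
    eulerOp k (laurentMonomial v) = (v k : ℂ) • laurentMonomial v := by
  rw [laurentMonomial, eulerOp_single, AddMonoidAlgebra.smul_single, smul_eq_mul]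

/-- The operator multiplies `t^v` by `v k`, which is zero for `v = 0`. This is the algebraic
counterpart of `integral_leftDeriv_eq_zero`. -/
theorem constTerm_eulerOp (k : Fin N) (x : AddMonoidAlgebra ℂ (Fin N → ℤ)) :
    constTerm (eulerOp k x) = 0 := by
  induction x using AddMonoidAlgebra.induction_linear with
  | zero => simp
  | add x y hx hy => rw [map_add, map_add, hx, hy, add_zero]
  | single v c =>
    rw [eulerOp_single, constTerm_single]
    split_ifs with h
    · simp [h]
    · rfl

theorem constTerm_smul (c : ℂ) (x : AddMonoidAlgebra ℂ (Fin N → ℤ)) :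
    constTerm (c • x) = c * constTerm x := rfl

theorem eulerOp_mul (k : Fin N) (x y : AddMonoidAlgebra ℂ (Fin N → ℤ)) :
    eulerOp k (x * y) = eulerOp k x * y + x * eulerOp k y := by
  induction x using AddMonoidAlgebra.induction_linear with
  | zero => simp
  | add x x' hx hx' => rw [add_mul, map_add, hx, hx', map_add]; ring
  | single v c =>
    induction y using AddMonoidAlgebra.induction_linear with
    | zero => simp
    | add y y' hy hy' => rw [mul_add, map_add, hy, hy', map_add]; ring
    | single w d =>
      simp only [AddMonoidAlgebra.single_mul_single, eulerOp_single, ← AddMonoidAlgebra.single_add]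
      congr 1
      push_cast [Pi.add_apply]
      ring

theorem eulerOp_prod {ι : Type*} [DecidableEq ι] (k : Fin N) (F : Finset ι)
    (f : ι → AddMonoidAlgebra ℂ (Fin N → ℤ)) :
    eulerOp k (∏ i ∈ F, f i) = ∑ i ∈ F, eulerOp k (f i) * ∏ j ∈ F.erase i, f j := by
  induction F using Finset.induction_on with
  | empty => simpa [laurentMonomial_zero] using eulerOp_monomial k 0
  | insert a F ha ih =>
    rw [Finset.prod_insert ha, eulerOp_mul, ih, Finset.sum_insert ha, Finset.erase_insert ha,
      Finset.mul_sum]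
    congr 1
    refine Finset.sum_congr rfl fun i hi => ?_
    have : a ≠ i := fun h => ha (h ▸ hi)
    rw [Finset.erase_insert_of_ne this, Finset.prod_insert fun h => ha (Finset.mem_of_mem_erase h)]
    ring

/-- Permutation of the variables of Laurent polynomials. -/
noncomputable def permVars (π : Equiv.Perm (Fin N)) :
    AddMonoidAlgebra ℂ (Fin N → ℤ) →+* AddMonoidAlgebra ℂ (Fin N → ℤ) :=
  AddMonoidAlgebra.mapDomainRingHom ℂ
    ({ toFun := fun v => v ∘ π, map_zero' := rfl, map_add' := fun _ _ => rfl } :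
      (Fin N → ℤ) →+ (Fin N → ℤ))

theorem permVars_single (π : Equiv.Perm (Fin N)) (v : Fin N → ℤ) (c : ℂ) :
    permVars π (AddMonoidAlgebra.single v c) = AddMonoidAlgebra.single (v ∘ π) c := by
  simp [permVars]

theorem permVars_monomial (π : Equiv.Perm (Fin N)) (v : Fin N → ℤ) :
    permVars π (laurentMonomial v) = laurentMonomial (v ∘ π) := permVars_single π v 1

theorem constTerm_permVars (π : Equiv.Perm (Fin N)) (x : AddMonoidAlgebra ℂ (Fin N → ℤ)) :
    constTerm (permVars π x) = constTerm x := by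
  induction x using AddMonoidAlgebra.induction_linear with
  | zero => simp
  | add x y hx hy => rw [map_add, map_add, map_add, hx, hy]
  | single v c =>
    rw [permVars_single, constTerm_single, constTerm_single]
    have : v ∘ π = 0 ↔ v = 0 := by
      rw [← (π.surjective.injective_comp_right (γ := ℤ)).eq_iff (a := v) (b := 0)]
      rfl
    simp [this]

/-- The ratio `t_a / t_b` for `q = (a, b)`. -/
noncomputable def rootMonomial (q : Fin N × Fin N) : AddMonoidAlgebra ℂ (Fin N → ℤ) :=
  laurentMonomial (Pi.single q.1 1 - Pi.single q.2 1)

theorem rootMonomial_mul_swap (a b : Fin N) : rootMonomial (a, b) * rootMonomial (b, a) = 1 := by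
  rw [rootMonomial, rootMonomial, laurentMonomial_mul]
  simp [laurentMonomial_zero]

theorem permVars_rootMonomial (π : Equiv.Perm (Fin N)) (q : Fin N × Fin N) :
    permVars π (rootMonomial q) = rootMonomial (π.symm q.1, π.symm q.2) := by
  rw [rootMonomial, permVars_monomial, rootMonomial]
  congr 1
  ext j
  simp [Pi.single_apply, Equiv.eq_symm_apply]

/-- The Weyl denominator `∏_{a ≠ b} (1 - t_a/t_b)`. -/
noncomputable def weylWeight (N : ℕ) : AddMonoidAlgebra ℂ (Fin N → ℤ) :=
  ∏ q ∈ (Finset.univ : Finset (Fin N)).offDiag, (1 - rootMonomial q)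

/-- The factors of `weylWeight` not involving both `t_k` and `t_i`. -/
noncomputable def weylCofactor (k i : Fin N) : AddMonoidAlgebra ℂ (Fin N → ℤ) :=
  ∏ q ∈ ((Finset.univ : Finset (Fin N)).offDiag.erase (k, i)).erase (i, k), (1 - rootMonomial q)

theorem prod_erase_left {k i : Fin N} (h : i ≠ k) :
    ∏ q ∈ (Finset.univ : Finset (Fin N)).offDiag.erase (k, i), (1 - rootMonomial q) =
      (1 - rootMonomial (i, k)) * weylCofactor k i :=
  (Finset.mul_prod_erase _ _ (by simp [h])).symm

theorem prod_erase_right {k i : Fin N} (h : i ≠ k) :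
    ∏ q ∈ (Finset.univ : Finset (Fin N)).offDiag.erase (i, k), (1 - rootMonomial q) =
      (1 - rootMonomial (k, i)) * weylCofactor k i := by
  rw [weylCofactor, Finset.erase_right_comm]
  exact (Finset.mul_prod_erase _ _ (by simp [h.symm])).symm

/-- With `x = t_k/t_i` the two factors removed multiply to `(1 - x)(1 - x⁻¹) = 2 - x - x⁻¹`.
Multiplication by it is a second difference in the exponent, which is why the sums in the loop
equation telescope. -/
theorem weylWeight_eq_mul_cofactor {k i : Fin N} (h : i ≠ k) :
    weylWeight N = (1 + 1 - rootMonomial (k, i) - rootMonomial (i, k)) * weylCofactor k i := by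
  rw [weylWeight, ← Finset.mul_prod_erase _ _ (show (k, i) ∈ _ by simp [h.symm]),
    prod_erase_left h]
  linear_combination weylCofactor k i * rootMonomial_mul_swap k i

theorem permVars_weylCofactor (k i : Fin N) :
    permVars (Equiv.swap k i) (weylCofactor k i) = weylCofactor k i := by
  rw [weylCofactor, map_prod]
  refine Finset.prod_equiv ((Equiv.swap k i).prodCongr (Equiv.swap k i)) ?_ ?_
  · rintro ⟨a, b⟩
    simp only [Finset.mem_erase, Finset.mem_offDiag, Finset.mem_univ, true_and,
      Equiv.prodCongr_apply, Prod.map_apply, ne_eq, Prod.mk.injEq, Equiv.apply_eq_iff_eq,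
      Equiv.swap_apply_eq_iff, Equiv.swap_apply_left, Equiv.swap_apply_right]
    tauto
  · rintro ⟨a, b⟩ _
    simp [permVars_rootMonomial]

/-- Only factors containing `t_k` contribute. For each `i` they form the pair `2 - x - x⁻¹` with `x
= t_k/t_i`, whose derivative is `x⁻¹ - x`. -/
theorem eulerOp_weylWeight (k : Fin N) :
    eulerOp k (weylWeight N) = ∑ i ∈ Finset.univ.erase k,
      (rootMonomial (i, k) - rootMonomial (k, i)) * weylCofactor k i := by
  have hD : ∀ q : Fin N × Fin N, eulerOp k (1 - rootMonomial q) =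
      (if q.2 = k then rootMonomial q else 0) - (if q.1 = k then rootMonomial q else 0) := by
    intro q
    have h1 : eulerOp k (1 : AddMonoidAlgebra ℂ (Fin N → ℤ)) = 0 := by
      simpa [laurentMonomial_zero] using eulerOp_monomial k (0 : Fin N → ℤ)
    rw [map_sub, h1, rootMonomial, eulerOp_monomial]
    simp only [Pi.sub_apply, Pi.single_apply, eq_comm (a := k)]
    split_ifs <;> simp
  rw [weylWeight, eulerOp_prod]
  simp only [hD, sub_mul, ite_mul, zero_mul, Finset.sum_sub_distrib]
  have hfst : ∀ g : Fin N × Fin N → AddMonoidAlgebra ℂ (Fin N → ℤ),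
      ∑ q ∈ (Finset.univ : Finset (Fin N)).offDiag, (if q.1 = k then g q else 0) =
      ∑ i ∈ Finset.univ.erase k, g (k, i) := by
    intro g
    rw [← Finset.sum_filter]
    refine Finset.sum_bij' (fun q _ => q.2) (fun i _ => (k, i)) ?_ ?_ ?_ ?_ ?_ <;> aesop
  have hsnd : ∀ g : Fin N × Fin N → AddMonoidAlgebra ℂ (Fin N → ℤ),
      ∑ q ∈ (Finset.univ : Finset (Fin N)).offDiag, (if q.2 = k then g q else 0) =
      ∑ i ∈ Finset.univ.erase k, g (i, k) := by
    intro g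
    rw [← Finset.sum_filter]
    refine Finset.sum_bij' (fun q _ => q.1) (fun i _ => (i, k)) ?_ ?_ ?_ ?_ ?_ <;> aesop
  rw [hfst, hsnd, ← Finset.sum_sub_distrib, ← Finset.sum_sub_distrib]
  refine Finset.sum_congr rfl fun i hi => ?_
  have hi := Finset.ne_of_mem_erase hi
  rw [prod_erase_left hi, prod_erase_right hi]
  ring

theorem update_update_add_single {s : Fin N → ℤ} {k i : Fin N} (h : i ≠ k) (l S e : ℤ) :
    Function.update (Function.update s k l) i (S - l) + (Pi.single k e - Pi.single i e) =
      Function.update (Function.update s k (l + e)) i (S - (l + e)) := by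
  ext j
  by_cases h1 : j = i
  · subst h1; simp [h]; ring
  · by_cases h2 : j = k
    · subst h2; simp [h1]
    · simp [h1, h2]

/-- The loop equations for the constant term functional with the Weyl weight. -/
theorem constTerm_loop_equation (s : Fin N → ℤ) (k : Fin N) :
    (s k : ℂ) * constTerm (laurentMonomial s * weylWeight N) + ∑ i ∈ Finset.univ.erase k,
      (zsum (fun l => constTerm (laurentMonomial
        (Function.update (Function.update s k l) i (s k + s i - l)) * weylWeight N)) (s k) -
       zsum (fun l => constTerm (laurentMonomial
        (Function.update (Function.update s k l) i (s k + s i - l)) * weylWeight N)) (s i)) = 0 := by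
  have h0 := constTerm_eulerOp k (laurentMonomial s * weylWeight N)
  rw [eulerOp_mul, eulerOp_monomial, eulerOp_weylWeight, Finset.mul_sum, smul_mul_assoc, map_add,
    constTerm_smul, map_sum] at h0
  rw [← h0]
  congr 1
  refine Finset.sum_congr rfl fun i hi => ?_
  have hi := Finset.ne_of_mem_erase hi
  set S := s k + s i with hS
  let j : ℤ → ℂ := fun l => constTerm (laurentMonomial
    (Function.update (Function.update s k l) i (S - l)) * weylCofactor k i)
  have hright : ∀ l, laurentMonomial (Function.update (Function.update s k l) i (S - l)) *
      rootMonomial (k, i) = laurentMonomial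
        (Function.update (Function.update s k (l + 1)) i (S - (l + 1))) := by
    intro l
    rw [rootMonomial, laurentMonomial_mul, update_update_add_single hi]
  have hleft : ∀ l, laurentMonomial (Function.update (Function.update s k l) i (S - l)) *
      rootMonomial (i, k) = laurentMonomial
        (Function.update (Function.update s k (l - 1)) i (S - (l - 1))) := by
    intro l
    rw [rootMonomial, laurentMonomial_mul, sub_eq_add_neg l, ← update_update_add_single hi]
    congr 1
    simp only [Pi.single_neg]
    abel
  have hm : ∀ l, constTerm (laurentMonomial
      (Function.update (Function.update s k l) i (S - l)) * weylWeight N) =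
      j l + j l - j (l + 1) - j (l - 1) := by
    intro l
    simp only [j, ← hright, ← hleft, ← map_add, ← map_sub]
    rw [weylWeight_eq_mul_cofactor hi]
    congr 1
    ring
  have hself : Function.update (Function.update s k (s k)) i (S - s k) = s := by
    rw [hS, add_sub_cancel_left]; simp
  -- The cofactor is symmetric in `t_k` and `t_i`, and the constant term is invariant under
  -- permuting the variables.
  have hsymm : ∀ l, j (S - l) = j l := by
    intro l
    simp only [j]
    rw [← constTerm_permVars (Equiv.swap k i), map_mul, permVars_weylCofactor, permVars_monomial]
    congr 3
    ext x
    by_cases h1 : x = i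
    · subst h1; simp [hi.symm]
    · by_cases h2 : x = k
      · subst h2; simp [h1]
      · simp [h1, h2, Equiv.swap_apply_of_ne_of_ne h2 h1]
  simp only [hm]
  -- What remains are boundary terms at `s k` and `s i = S - s k`. By the symmetry of `j` they
  -- combine to `j (s k - 1) - j (s k + 1)`, the contribution of the derivative of the weight.
  rw [zsum_sub_zsum_second_diff]
  have e1 : j (s i) = j (s k) := by rw [← hsymm]; congr 1; omega
  have e2 : j (s i + 1) = j (s k - 1) := by rw [← hsymm]; congr 1; omega
  have e3 : constTerm (laurentMonomial s *
      ((rootMonomial (i, k) - rootMonomial (k, i)) * weylCofactor k i)) =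
      j (s k - 1) - j (s k + 1) := by
    simp only [j, ← hright, ← hleft, ← map_sub, hself]
    congr 1
    ring
  rw [e1, e2, e3]
  ring

/-- The Toeplitz matrix with the symbol `t^s`. -/
def toeplitzShift (N : ℕ) (s : ℤ) : Matrix (Fin N) (Fin N) ℂ :=
  Matrix.of fun j k => if ((k : ℕ) : ℤ) - ((j : ℕ) : ℤ) = s then 1 else 0

/-- The factors for `(i, j)` and `(j, i)` multiply to `(t_j - t_i)(t_j⁻¹ - t_i⁻¹)`, so the weight is
the product of the Vandermonde determinants in `t` and in `t⁻¹`. -/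
theorem weylWeight_eq_sum : weylWeight N = ∑ σ : Equiv.Perm (Fin N), ∑ τ : Equiv.Perm (Fin N),
    (((Equiv.Perm.sign σ : ℤ) : ℂ) * ((Equiv.Perm.sign τ : ℤ) : ℂ)) •
      laurentMonomial fun k => ((σ k : ℕ) : ℤ) - ((τ k : ℕ) : ℤ) := by
  have hdet : ∀ (e : ℤ), Matrix.det (Matrix.vandermonde fun i : Fin N =>
      laurentMonomial (Pi.single i e)) = ∑ σ : Equiv.Perm (Fin N),
      ((Equiv.Perm.sign σ : ℤ) : ℂ) • laurentMonomial fun k => e * ((σ k : ℕ) : ℤ) := by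
    intro e
    rw [← Matrix.det_transpose, Matrix.det_apply]
    refine Finset.sum_congr rfl fun σ _ => ?_
    simp only [Matrix.transpose_apply, Matrix.vandermonde_apply, laurentMonomial_pow,
      laurentMonomial_prod]
    rw [Units.smul_def, Int.cast_smul_eq_zsmul]
    congr 2
    ext x
    simp [Finset.sum_apply, Pi.single_apply, mul_comm]
  have hprod : weylWeight N = Matrix.det (Matrix.vandermonde fun i : Fin N =>
      laurentMonomial (Pi.single i 1)) * Matrix.det (Matrix.vandermonde fun i : Fin N =>
      laurentMonomial (Pi.single i (-1))) := by
    rw [Matrix.det_vandermonde, Matrix.det_vandermonde, ← Finset.prod_mul_distrib]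
    simp only [← Finset.prod_mul_distrib]
    have : ∀ i j : Fin N, (laurentMonomial (Pi.single j 1) - laurentMonomial (Pi.single i 1)) *
        (laurentMonomial (Pi.single j (-1)) - laurentMonomial (Pi.single i (-1))) =
        (1 - rootMonomial (j, i)) * (1 - rootMonomial (i, j)) := by
      intro i j
      have h1 : ∀ a b : Fin N, laurentMonomial (Pi.single a 1) * laurentMonomial (Pi.single b (-1)) =
          rootMonomial (a, b) := by
        intro a b
        rw [laurentMonomial_mul, rootMonomial, Pi.single_neg, ← sub_eq_add_neg]
      have h2 : ∀ a : Fin N, rootMonomial (a, a) = 1 := by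
        intro a; simp [rootMonomial, laurentMonomial_zero]
      linear_combination h1 j j - h1 j i - h1 i j + h1 i i + h2 i + h2 j -
        rootMonomial_mul_swap j i
    simp only [this]
    rw [Finset.prod_prod_Ioi_mul_eq_prod_prod_off_diag fun a b => 1 - rootMonomial (a, b)]
    rw [weylWeight, Finset.prod_sigma']
    refine Finset.prod_bij' (fun q _ => ⟨q.2, q.1⟩) (fun x _ => (x.2, x.1)) ?_ ?_ ?_ ?_ ?_ <;> aesop
  rw [hprod, hdet, hdet, Finset.sum_mul_sum]
  refine Finset.sum_congr rfl fun σ _ => Finset.sum_congr rfl fun τ _ => ?_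
  rw [smul_mul_smul_comm, laurentMonomial_mul]
  congr 2
  ext x
  simp [sub_eq_add_neg]

/-- In the double Vandermonde expansion, the term of `(σ, τ)` has a constant term exactly when `τ k
- σ k = s k` for all `k`, which is the product of the Toeplitz entries. -/
theorem mixedDet_toeplitzShift (s : Fin N → ℤ) :
    mixedDet (fun k => toeplitzShift N (s k)) = constTerm (laurentMonomial s * weylWeight N) := by
  rw [weylWeight_eq_sum, Finset.mul_sum, map_sum]
  refine Finset.sum_congr rfl fun σ _ => ?_
  rw [Finset.mul_sum, map_sum]
  refine Finset.sum_congr rfl fun τ _ => ?_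
  rw [mul_smul_comm, constTerm_smul, laurentMonomial_mul]
  congr 1
  rw [laurentMonomial, constTerm_single]
  simp only [toeplitzShift, Matrix.of_apply, Finset.prod_ite_zero, Finset.prod_const_one,
    Finset.mem_univ, true_implies]
  refine if_congr ?_ rfl rfl
  rw [funext_iff]
  refine forall_congr' fun x => ?_
  simp only [Pi.add_apply, Pi.zero_apply]
  omega

/-- The moments of Haar measure on `U(N)` are Toeplitz determinants. -/
theorem integral_mixedPow (s : Fin N → ℤ) :
    ∫ U, mixedPow U s ∂haarU N = mixedDet fun k => toeplitzShift N (s k) := by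
  rw [← sub_eq_zero]
  refine eq_zero_of_loop_equations
    (fun s => ∫ U, mixedPow U s ∂haarU N - mixedDet fun k => toeplitzShift N (s k)) ?_ ?_ ?_ s
  · intro π s
    have h1 : ∀ U : Matrix.unitaryGroup (Fin N) ℂ, mixedPow U (s ∘ π) = mixedPow U s :=
      fun U => mixedDet_comp_perm π fun j => (U ^ s j).1
    simp only [h1]
    exact congrArg _ (mixedDet_comp_perm π fun j => toeplitzShift N (s j))
  · intro s k
    have h1 := haar_loop_equation s k
    have h2 := constTerm_loop_equation s k
    simp only [← mixedDet_toeplitzShift] at h2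
    simp only [zsum_sub_distrib]
    rw [← sub_zero (0 : ℂ)]
    nth_rw 1 [← h1]
    rw [← h2, add_sub_add_comm, ← mul_sub, ← Finset.sum_sub_distrib]
    congr 1
    refine Finset.sum_congr rfl fun i _ => ?_
    ring
  -- At the origin both sides are the polarised determinant of the identity, `N!`.
  · have h1 : ∀ U : Matrix.unitaryGroup (Fin N) ℂ, mixedPow U 0 = N.factorial := by
      intro U
      have : mixedPow U 0 = mixedDet fun _ : Fin N => (1 : Matrix (Fin N) (Fin N) ℂ) := by
        simp [mixedPow]
      rw [this, mixedDet_const]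
      simp
    have h2 : toeplitzShift N 0 = 1 := by
      ext j k
      simp only [toeplitzShift, Matrix.of_apply, Matrix.one_apply]
      refine if_congr ?_ rfl rfl
      rw [Fin.ext_iff]
      omega
    simp [h1, h2, mixedDet_const]

end LaurentPolynomials

/-! ### Products over the spectrum as determinants -/

section SpectralProduct

variable {N : ℕ}

/-- The product of `f` over the eigenvalues of a matrix, i.e. `det f(A)`. -/
noncomputable def spectralProd (f : ℂ → ℂ) (A : Matrix (Fin N) (Fin N) ℂ) : ℂ :=
  (A.charpoly.roots.map f).prod

theorem card_roots_charpoly (A : Matrix (Fin N) (Fin N) ℂ) : A.charpoly.roots.card = N := by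
  rw [← (IsAlgClosed.splits A.charpoly).natDegree_eq_card_roots, Matrix.charpoly_natDegree_eq_dim,
    Fintype.card_fin]

theorem det_sub_scalar (A : Matrix (Fin N) (Fin N) ℂ) (a : ℂ) :
    (A - Matrix.scalar (Fin N) a).det = (A.charpoly.roots.map fun t => t - a).prod := by
  have h1 : (Matrix.scalar (Fin N) a - A).det = (A.charpoly.roots.map fun t => a - t).prod := by
    rw [← Matrix.eval_charpoly]
    nth_rw 1 [(IsAlgClosed.splits A.charpoly).eq_prod_roots_of_monic A.charpoly_monic]
    rw [Polynomial.eval_multiset_prod, Multiset.map_map]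
    simp
  rw [← neg_sub, Matrix.det_neg, h1, Fintype.card_fin]
  have h2 : (A.charpoly.roots.map fun t => t - a) =
      A.charpoly.roots.map fun t => (-1) * (a - t) := by
    refine Multiset.map_congr rfl fun t _ => by ring
  rw [h2, Multiset.prod_map_mul, Multiset.map_const', Multiset.prod_replicate, card_roots_charpoly]

/-- Both sides are multiplicative in `p`, which splits into linear factors over `ℂ`. For `X - a` the
claim is the factorisation of the characteristic polynomial. -/
theorem det_aeval (A : Matrix (Fin N) (Fin N) ℂ) (p : Polynomial ℂ) :
    (Polynomial.aeval A p).det = spectralProd (fun t => p.eval t) A := by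
  rw [(IsAlgClosed.splits p).eq_prod_roots]
  set c := p.leadingCoeff
  set r := p.roots
  clear_value c r
  induction r using Multiset.induction_on with
  | empty =>
    simp only [Multiset.map_zero, Multiset.prod_zero, mul_one, Polynomial.aeval_C,
      Polynomial.eval_C, spectralProd, Multiset.map_const', Multiset.prod_replicate,
      card_roots_charpoly]
    rw [Matrix.algebraMap_eq_diagonal, Matrix.det_diagonal]
    simp
  | cons a r ih =>
    rw [Multiset.map_cons, Multiset.prod_cons, mul_left_comm, map_mul, Matrix.det_mul, ih]
    have : Polynomial.aeval A (Polynomial.X - Polynomial.C a) = A - Matrix.scalar (Fin N) a := by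
      simp [Matrix.algebraMap_eq_diagonal, Pi.algebraMap_def]
    rw [this, det_sub_scalar, spectralProd, spectralProd, ← Multiset.prod_map_mul]
    refine congrArg _ (Multiset.map_congr rfl fun t _ => ?_)
    simp

theorem norm_eq_one_of_mem_roots_charpoly {U : Matrix.unitaryGroup (Fin N) ℂ} {t : ℂ}
    (ht : t ∈ U.1.charpoly.roots) : ‖t‖ = 1 := by
  have h1 : t ∈ spectrum ℂ U.1 :=
    Matrix.mem_spectrum_of_isRoot_charpoly (Polynomial.isRoot_of_mem_roots ht)
  open scoped Matrix.Norms.L2Operator in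
  have h2 := Unitary.spectrum_subset_circle (𝕜 := ℂ) U h1
  simpa using h2

/-- Multiplication by a power `U^n` clears the negative exponents and reduces to `det_aeval`. The
factor `det U^n` cancels because the eigenvalues lie on the unit circle. -/
theorem det_sum_zpow (F : Finset ℤ) (c : ℤ → ℂ) (U : Matrix.unitaryGroup (Fin N) ℂ) :
    (∑ s ∈ F, c s • (U ^ s).1).det = spectralProd (fun t => ∑ s ∈ F, c s * t ^ s) U.1 := by
  obtain ⟨n, hn⟩ : ∃ n : ℕ, ∀ s ∈ F, 0 ≤ s + n := by
    refine ⟨∑ s ∈ F, s.natAbs, fun s hs => ?_⟩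
    have : s.natAbs ≤ ∑ s ∈ F, s.natAbs :=
      Finset.single_le_sum (f := fun s : ℤ => s.natAbs) (fun _ _ => Nat.zero_le _) hs
    omega
  let p : Polynomial ℂ := ∑ s ∈ F, Polynomial.C (c s) * Polynomial.X ^ (s + n).toNat
  have h1 : Polynomial.aeval U.1 p = U.1 ^ n * ∑ s ∈ F, c s • (U ^ s).1 := by
    simp only [p, map_sum, map_mul, Polynomial.aeval_C, map_pow, Polynomial.aeval_X,
      Finset.mul_sum, Algebra.algebraMap_eq_smul_one, smul_mul_assoc, one_mul, mul_smul_comm]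
    refine Finset.sum_congr rfl fun s hs => ?_
    congr 1
    rw [← SubmonoidClass.coe_pow, ← SubmonoidClass.coe_pow, ← Submonoid.coe_mul, ← zpow_natCast,
      ← zpow_natCast, ← zpow_add, Int.toNat_of_nonneg (hn s hs), add_comm]
  have h2 := congrArg Matrix.det h1
  have hpow : (U.1.charpoly.roots.map fun t => t ^ n).prod = U.1.charpoly.roots.prod ^ n := by
    simpa using Multiset.prod_map_pow (m := U.1.charpoly.roots) (f := id) (n := n)
  rw [det_aeval, Matrix.det_mul, Matrix.det_pow, Matrix.det_eq_prod_roots_charpoly U.1,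
    ← hpow] at h2
  have h3 : spectralProd (fun t => p.eval t) U.1 =
      (U.1.charpoly.roots.map fun t => t ^ n).prod *
        spectralProd (fun t => ∑ s ∈ F, c s * t ^ s) U.1 := by
    rw [spectralProd, spectralProd, ← Multiset.prod_map_mul]
    refine congrArg _ (Multiset.map_congr rfl fun t ht => ?_)
    have ht0 : t ≠ 0 := by
      rintro rfl
      simpa using norm_eq_one_of_mem_roots_charpoly ht
    simp only [p, Polynomial.eval_finsetSum, Polynomial.eval_mul, Polynomial.eval_C,
      Polynomial.eval_pow, Polynomial.eval_X, Finset.mul_sum]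
    refine Finset.sum_congr rfl fun s hs => ?_
    rw [← zpow_natCast, ← zpow_natCast, Int.toNat_of_nonneg (hn s hs), zpow_add₀ ht0]
    ring
  rw [h3] at h2
  have h4 : (U.1.charpoly.roots.map fun t => t ^ n).prod ≠ 0 := by
    refine Multiset.prod_ne_zero fun h => ?_
    obtain ⟨t, ht, h0⟩ := Multiset.mem_map.1 h
    have := norm_eq_one_of_mem_roots_charpoly ht
    have h1 := congrArg norm h0
    simp [this] at h1
  exact (mul_left_cancel₀ h4 h2).symm

theorem continuous_spectralProd_laurent (F : Finset ℤ) (c : ℤ → ℂ) :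
    Continuous fun U : Matrix.unitaryGroup (Fin N) ℂ =>
      spectralProd (fun t => ∑ s ∈ F, c s * t ^ s) U.1 := by
  simp only [← det_sum_zpow]
  exact (continuous_finsetSum _ fun s _ => (continuous_coe_zpow s).const_smul (c s)).matrix_det

/-- After multiplication by `N!` both sides expand over the same index set by `mixedDet_sum_smul`,
and `integral_mixedPow` identifies them term by term. -/
theorem integral_spectralProd_laurent (F : Finset ℤ) (c : ℤ → ℂ) :
    ∫ U, spectralProd (fun t => ∑ s ∈ F, c s * t ^ s) U.1 ∂haarU N =
      (∑ s ∈ F, c s • toeplitzShift N s).det := by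
  have hN : (N.factorial : ℂ) ≠ 0 := by exact_mod_cast N.factorial_ne_zero
  refine mul_left_cancel₀ hN ?_
  have h1 := mixedDet_sum_smul (n := Fin N) F c (toeplitzShift N)
  rw [mixedDet_const, Fintype.card_fin] at h1
  rw [h1, ← integral_const_mul]
  have h2 : ∀ U : Matrix.unitaryGroup (Fin N) ℂ,
      N.factorial * spectralProd (fun t => ∑ s ∈ F, c s * t ^ s) U.1 =
      ∑ p ∈ Fintype.piFinset fun _ : Fin N => F, (∏ k, c (p k)) * mixedPow U p := by
    intro U
    have h3 := mixedDet_sum_smul (n := Fin N) F c fun s => (U ^ s).1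
    rw [mixedDet_const, Fintype.card_fin, det_sum_zpow] at h3
    exact h3
  simp only [h2]
  rw [integral_finsetSum _ fun p _ => ((continuous_mixedPow p).integrable_haarU).const_mul _]
  refine Finset.sum_congr rfl fun p _ => ?_
  rw [integral_const_mul, integral_mixedPow]

end SpectralProduct

/-! ### The Heine–Szegő identity -/

section HeineSzego

variable {N : ℕ}

/-- The restriction to the unit circle of a function on the complex plane. -/
noncomputable def circleRestrict (f : ℂ → ℂ) (x : UnitAddCircle) : ℂ := f (AddCircle.toCircle x)

/-- The Toeplitz matrix with the symbol `f`. -/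
noncomputable def toeplitz (N : ℕ) (f : ℂ → ℂ) : Matrix (Fin N) (Fin N) ℂ :=
  Matrix.of fun j k => fourierCoeff (circleRestrict f) (((k : ℕ) : ℤ) - ((j : ℕ) : ℤ))

theorem exists_toCircle_eq {t : ℂ} (ht : ‖t‖ = 1) :
    ∃ x : UnitAddCircle, (AddCircle.toCircle x : ℂ) = t := by
  obtain ⟨x, hx⟩ := (AddCircle.homeomorphCircle (T := 1) one_ne_zero).surjective
    ⟨t, mem_sphere_zero_iff_norm.2 ht⟩
  rw [AddCircle.homeomorphCircle_apply] at hx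
  exact ⟨x, congrArg Subtype.val hx⟩

theorem circleRestrict_laurent (F : Finset ℤ) (c : ℤ → ℂ) (x : UnitAddCircle) :
    circleRestrict (fun t => ∑ s ∈ F, c s * t ^ s) x = ∑ s ∈ F, c s * fourier s x := by
  refine Finset.sum_congr rfl fun s _ => ?_
  rw [fourier_apply, AddCircle.toCircle_zsmul, Circle.coe_zpow]

theorem toeplitz_laurent (F : Finset ℤ) (c : ℤ → ℂ) :
    toeplitz N (fun t => ∑ s ∈ F, c s * t ^ s) = ∑ s ∈ F, c s • toeplitzShift N s := by
  ext j k
  have h : circleRestrict (fun t => ∑ s ∈ F, c s * t ^ s) =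
      ∑ s ∈ F, c s • (fourier s : UnitAddCircle → ℂ) := by
    ext x
    rw [circleRestrict_laurent]
    simp
  rw [toeplitz, Matrix.of_apply, h, fourierCoeff.sum]
  · simp only [Finset.sum_apply, fourierCoeff.const_smul, fourierCoeff_fourier, Matrix.sum_apply,
      Matrix.smul_apply, toeplitzShift, Matrix.of_apply, Pi.single_apply]
  · intro s _
    exact ((map_continuous (fourier s)).integrable_of_hasCompactSupport
      (HasCompactSupport.of_compactSpace _)).smul (c s)

theorem tendsto_spectralProd {f : ℕ → ℂ → ℂ} {g : ℂ → ℂ}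
    (h : ∀ t : ℂ, ‖t‖ = 1 → Tendsto (fun n => f n t) atTop (𝓝 (g t)))
    (U : Matrix.unitaryGroup (Fin N) ℂ) :
    Tendsto (fun n => spectralProd (f n) U.1) atTop (𝓝 (spectralProd g U.1)) :=
  tendsto_multiset_prod _ fun t ht => h t (norm_eq_one_of_mem_roots_charpoly ht)

/-- Since the absolute value is again a spectral product, Heine–Szegő also computes `L¹` norms. -/
theorem norm_spectralProd (f : ℂ → ℂ) (A : Matrix (Fin N) (Fin N) ℂ) :
    (‖spectralProd f A‖ : ℂ) = spectralProd (fun t => (‖f t‖ : ℂ)) A := by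
  unfold spectralProd
  induction A.charpoly.roots using Multiset.induction_on with
  | empty => simp
  | cons a r ih => simp [ih]

theorem norm_spectralProd_mono {f g : ℂ → ℂ} {U : Matrix.unitaryGroup (Fin N) ℂ}
    (h : ∀ t : ℂ, ‖t‖ = 1 → ‖f t‖ ≤ ‖g t‖) : ‖spectralProd f U.1‖ ≤ ‖spectralProd g U.1‖ := by
  have hU : ∀ t ∈ U.1.charpoly.roots, ‖f t‖ ≤ ‖g t‖ :=
    fun t ht => h t (norm_eq_one_of_mem_roots_charpoly ht)
  unfold spectralProd
  generalize U.1.charpoly.roots = r at hU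
  induction r using Multiset.induction_on with
  | empty => simp
  | cons a r ih =>
    simp only [Multiset.map_cons, Multiset.prod_cons, norm_mul]
    exact mul_le_mul (hU a (Multiset.mem_cons_self a r))
      (ih fun t ht => hU t (Multiset.mem_cons_of_mem ht)) (norm_nonneg _) (norm_nonneg _)

/-- Dominated convergence for each Fourier coefficient, followed by continuity of the determinant.
-/
theorem tendsto_det_toeplitz {f : ℕ → ℂ → ℂ} {g : ℂ → ℂ} {G : UnitAddCircle → ℝ}
    (hf : ∀ n, AEStronglyMeasurable (circleRestrict (f n)) AddCircle.haarAddCircle)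
    (hG : Integrable G AddCircle.haarAddCircle)
    (hb : ∀ n x, ‖circleRestrict (f n) x‖ ≤ G x)
    (h : ∀ t : ℂ, ‖t‖ = 1 → Tendsto (fun n => f n t) atTop (𝓝 (g t))) :
    Tendsto (fun n => (toeplitz N (f n)).det) atTop (𝓝 (toeplitz N g).det) := by
  have hc : ∀ m, Tendsto (fun n => fourierCoeff (circleRestrict (f n)) m) atTop
      (𝓝 (fourierCoeff (circleRestrict g) m)) := by
    intro m
    refine tendsto_integral_of_dominated_convergence G (fun n => ?_) hG (fun n => ?_) ?_
    · exact (map_continuous (fourier (-m))).aestronglyMeasurable.smul (hf n)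
    · refine Eventually.of_forall fun x => ?_
      rw [norm_smul, fourier_apply, Circle.norm_coe, one_mul]
      exact hb n x
    · refine Eventually.of_forall fun x => ?_
      exact (h _ (Circle.norm_coe _)).const_smul _
  refine ((continuous_id (X := Matrix (Fin N) (Fin N) ℂ)).matrix_det.tendsto _).comp ?_
  exact tendsto_pi_nhds.2 fun j => tendsto_pi_nhds.2 fun k => hc _

/-- The Heine–Szegő identity for continuous symbols. -/
theorem heineSzego_of_continuous {f : ℂ → ℂ} (hf : Continuous (circleRestrict f)) :
    Integrable (fun U : Matrix.unitaryGroup (Fin N) ℂ => spectralProd f U.1) (haarU N) ∧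
      ∫ U, spectralProd f U.1 ∂haarU N = (toeplitz N f).det := by
  -- Trigonometric polynomials are uniformly dense in the continuous functions on the circle.
  have happrox : ∀ n : ℕ, ∃ (F : Finset ℤ) (c : ℤ → ℂ), ∀ t : ℂ, ‖t‖ = 1 →
      ‖(∑ s ∈ F, c s * t ^ s) - f t‖ < 1 / ((n : ℝ) + 1) := by
    intro n
    have hmem : (⟨circleRestrict f, hf⟩ : C(UnitAddCircle, ℂ)) ∈
        (Submodule.span ℂ (Set.range (@fourier 1))).topologicalClosure := by
      rw [span_fourier_closure_eq_top]; trivial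
    obtain ⟨g, hg, hd⟩ := Metric.mem_closure_iff.1 hmem (1 / ((n : ℝ) + 1)) (by positivity)
    obtain ⟨c, rfl⟩ := Finsupp.mem_span_range_iff_exists_finsupp.1 hg
    refine ⟨c.support, c, fun t ht => ?_⟩
    obtain ⟨x, rfl⟩ := exists_toCircle_eq ht
    refine lt_of_le_of_lt ?_ hd
    rw [dist_comm]
    refine le_trans (le_of_eq ?_) (ContinuousMap.dist_apply_le_dist x)
    rw [dist_eq_norm]
    congr 2
    rw [Finsupp.sum, ContinuousMap.coe_sum, Finset.sum_apply]
    exact circleRestrict_laurent c.support c x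
  choose F c hFc using happrox
  let p : ℕ → ℂ → ℂ := fun n t => ∑ s ∈ F n, c n s * t ^ s
  obtain ⟨C, hC⟩ := (isCompact_univ (X := UnitAddCircle)).exists_bound_of_continuousOn
    hf.continuousOn
  have hfC : ∀ t : ℂ, ‖t‖ = 1 → ‖f t‖ ≤ C := by
    intro t ht
    obtain ⟨x, rfl⟩ := exists_toCircle_eq ht
    exact hC x (Set.mem_univ x)
  have hC0 : 0 ≤ C := (norm_nonneg _).trans (hfC 1 (by simp))
  have hpC : ∀ n (t : ℂ), ‖t‖ = 1 → ‖p n t‖ ≤ C + 1 := by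
    intro n t ht
    have h1 := hFc n t ht
    have h2 : 1 / ((n : ℝ) + 1) ≤ 1 := by
      rw [div_le_one (by positivity)]
      linarith [(Nat.cast_nonneg n : (0 : ℝ) ≤ n)]
    calc ‖p n t‖ = ‖(p n t - f t) + f t‖ := by rw [sub_add_cancel]
      _ ≤ ‖p n t - f t‖ + ‖f t‖ := norm_add_le _ _
      _ ≤ C + 1 := by linarith [hfC t ht]
  have hlim : ∀ t : ℂ, ‖t‖ = 1 → Tendsto (fun n => p n t) atTop (𝓝 (f t)) := by
    intro t ht
    rw [tendsto_iff_norm_sub_tendsto_zero]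
    exact squeeze_zero (fun n => norm_nonneg _) (fun n => (hFc n t ht).le)
      tendsto_one_div_add_atTop_nhds_zero_nat
  have hsp : ∀ n (U : Matrix.unitaryGroup (Fin N) ℂ), ‖spectralProd (p n) U.1‖ ≤ (C + 1) ^ N := by
    intro n U
    have h1 := norm_spectralProd_mono (U := U) (f := p n) (g := fun _ => ((C + 1 : ℝ) : ℂ))
      fun t ht => by
        rw [Complex.norm_real, Real.norm_of_nonneg (by linarith)]
        exact hpC n t ht
    refine h1.trans (le_of_eq ?_)
    rw [spectralProd, Multiset.map_const', Multiset.prod_replicate, card_roots_charpoly, norm_pow,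
      Complex.norm_real, Real.norm_of_nonneg (by linarith)]
  have hmeas : ∀ n, AEStronglyMeasurable
      (fun U : Matrix.unitaryGroup (Fin N) ℂ => spectralProd (p n) U.1) (haarU N) := fun n =>
    (continuous_spectralProd_laurent (F n) (c n)).integrable_haarU.aestronglyMeasurable
  have hpt : ∀ U : Matrix.unitaryGroup (Fin N) ℂ,
      Tendsto (fun n => spectralProd (p n) U.1) atTop (𝓝 (spectralProd f U.1)) :=
    tendsto_spectralProd hlim
  constructor
  · refine Integrable.of_bound (aestronglyMeasurable_of_tendsto_ae atTop hmeas
      (Eventually.of_forall hpt)) ((C + 1) ^ N) (Eventually.of_forall fun U => ?_)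
    exact le_of_tendsto (hpt U).norm (Eventually.of_forall fun n => hsp n U)
  · have h1 := tendsto_integral_of_dominated_convergence (μ := haarU N) (fun _ => (C + 1) ^ N)
      hmeas (integrable_const _) (fun n => Eventually.of_forall (hsp n)) (Eventually.of_forall hpt)
    refine tendsto_nhds_unique h1 ?_
    have h2 : ∀ n, ∫ U, spectralProd (p n) U.1 ∂haarU N = (toeplitz N (p n)).det := fun n => by
      rw [toeplitz_laurent]
      exact integral_spectralProd_laurent (F n) (c n)
    simp only [h2]
    refine tendsto_det_toeplitz (G := fun _ => C + 1) (fun n => ?_) (integrable_const _)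
      (fun n x => hpC n _ (Circle.norm_coe _)) hlim
    have : circleRestrict (p n) = fun x => ∑ s ∈ F n, c n s * fourier s x :=
      funext (circleRestrict_laurent (F n) (c n))
    rw [this]
    exact (continuous_finsetSum _ fun s _ =>
      continuous_const.mul (map_continuous (fourier s))).aestronglyMeasurable

/-- The Heine–Szegő identity for integrable symbols which are continuous away from one point
of the circle, at which they vanish. -/
theorem heineSzego_of_continuousOn {f : ℂ → ℂ} {t₀ : ℂ} (h0 : f t₀ = 0)
    (hf : ∀ x : UnitAddCircle, (AddCircle.toCircle x : ℂ) ≠ t₀ →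
      ContinuousAt (circleRestrict f) x)
    (hint : Integrable (circleRestrict f) AddCircle.haarAddCircle) :
    Integrable (fun U : Matrix.unitaryGroup (Fin N) ℂ => spectralProd f U.1) (haarU N) ∧
      ∫ U, spectralProd f U.1 ∂haarU N = (toeplitz N f).det := by
  -- A continuous cutoff, `0` where `n ‖t - t₀‖ ≤ 1` and `1` where `n ‖t - t₀‖ ≥ 2`.
  let χ : ℕ → ℂ → ℝ := fun n t => max 0 (min 1 (n * ‖t - t₀‖ - 1))
  have hχ0 : ∀ n t, 0 ≤ χ n t := fun n t => le_max_left _ _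
  have hχ1 : ∀ n t, χ n t ≤ 1 := fun n t => max_le zero_le_one (min_le_left _ _)
  have hχc : ∀ n, Continuous (χ n) := fun n => by fun_prop
  have hχlim : ∀ t, t ≠ t₀ → Tendsto (fun n => χ n t) atTop (𝓝 1) := by
    intro t ht
    have hpos : 0 < ‖t - t₀‖ := norm_pos_iff.2 (sub_ne_zero.2 ht)
    refine tendsto_const_nhds.congr' ?_
    obtain ⟨n₀, hn₀⟩ := exists_nat_gt (2 / ‖t - t₀‖)
    filter_upwards [eventually_ge_atTop n₀] with n hn
    have h1 : 2 / ‖t - t₀‖ < n := hn₀.trans_le (by exact_mod_cast hn)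
    rw [div_lt_iff₀ hpos] at h1
    simp only [χ]
    rw [min_eq_left (by linarith), max_eq_right zero_le_one]
  -- the truncation of a function
  have hcont : ∀ (g : ℂ → ℂ), (∀ x : UnitAddCircle, (AddCircle.toCircle x : ℂ) ≠ t₀ →
      ContinuousAt (circleRestrict g) x) → ∀ n,
      Continuous (circleRestrict fun t => (χ n t : ℂ) * g t) := by
    intro g hg n
    rw [continuous_iff_continuousAt]
    intro x
    have hcirc : Continuous fun x : UnitAddCircle => (AddCircle.toCircle x : ℂ) :=
      continuous_subtype_val.comp AddCircle.continuous_toCircle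
    by_cases hx : (AddCircle.toCircle x : ℂ) = t₀
    · have hz : (circleRestrict fun t => (χ n t : ℂ) * g t) =ᶠ[𝓝 x] fun _ => 0 := by
        have hopen : ∀ᶠ y in 𝓝 x, (n : ℝ) * ‖(AddCircle.toCircle y : ℂ) - t₀‖ < 1 := by
          refine (show Continuous fun y : UnitAddCircle =>
            (n : ℝ) * ‖(AddCircle.toCircle y : ℂ) - t₀‖ by fun_prop).continuousAt.eventually_lt
              continuousAt_const ?_
          simp [hx]
        filter_upwards [hopen] with y hy
        simp only [circleRestrict, χ]
        rw [max_eq_left ((min_le_right _ _).trans (by linarith))]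
        simp
      exact continuousAt_const.congr hz.symm
    · exact ((Complex.continuous_ofReal.comp ((hχc n).comp hcirc)).continuousAt).mul (hg x hx)
  let p : ℕ → ℂ → ℂ := fun n t => (χ n t : ℂ) * f t
  have hp := fun n => heineSzego_of_continuous (N := N) (hcont f hf n)
  have hle : ∀ n t, ‖p n t‖ ≤ ‖f t‖ := by
    intro n t
    simp only [p, norm_mul, Complex.norm_real, Real.norm_of_nonneg (hχ0 n t)]
    exact mul_le_of_le_one_left (norm_nonneg _) (hχ1 n t)
  have hlim : ∀ t, Tendsto (fun n => p n t) atTop (𝓝 (f t)) := by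
    intro t
    by_cases ht : t = t₀
    -- At `t₀` every truncation is zero, so convergence there needs `f t₀ = 0`.
    · simp [p, ht, h0]
    · have := ((Complex.continuous_ofReal.tendsto 1).comp (hχlim t ht)).mul_const (f t)
      simpa [p] using this
  have hpt : ∀ U : Matrix.unitaryGroup (Fin N) ℂ,
      Tendsto (fun n => spectralProd (p n) U.1) atTop (𝓝 (spectralProd f U.1)) :=
    tendsto_spectralProd fun t _ => hlim t
  have hmeas : ∀ n, AEStronglyMeasurable
      (fun U : Matrix.unitaryGroup (Fin N) ℂ => spectralProd (p n) U.1) (haarU N) :=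
    fun n => (hp n).1.aestronglyMeasurable
  -- integrability, by Fatou's lemma
  have hnorm := fun n => heineSzego_of_continuous (N := N)
    (hcont (fun t => (‖f t‖ : ℂ)) (fun x hx =>
      (Complex.continuous_ofReal.continuousAt).comp (hf x hx).norm) n)
  have hnormeq : ∀ n t, ((χ n t : ℂ) * (‖f t‖ : ℂ)) = ((‖p n t‖ : ℝ) : ℂ) := by
    intro n t
    simp only [p, norm_mul, Complex.norm_real, Real.norm_of_nonneg (hχ0 n t)]
    push_cast
    rfl
  have hlimnorm : Tendsto (fun n => (toeplitz N fun t => (χ n t : ℂ) * (‖f t‖ : ℂ)).det) atTop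
      (𝓝 (toeplitz N fun t => (‖f t‖ : ℂ)).det) := by
    refine tendsto_det_toeplitz (G := fun x => ‖circleRestrict f x‖) (fun n => ?_) hint.norm
      (fun n x => ?_) fun t _ => ?_
    · exact (hcont (fun t => (‖f t‖ : ℂ)) (fun x hx =>
        (Complex.continuous_ofReal.continuousAt).comp (hf x hx).norm) n).aestronglyMeasurable
    · simp only [circleRestrict, hnormeq, Complex.norm_real, norm_norm]
      exact hle n _
    · simp only [hnormeq]
      exact (Complex.continuous_ofReal.tendsto _).comp (hlim t).norm
  -- The `L¹` norm of each truncated product is the Toeplitz determinant of `χ_n |f|`. These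
  -- determinants converge, so Fatou's lemma gives a finite bound.
  have hintnorm : ∀ n, ((∫ U, ‖spectralProd (p n) U.1‖ ∂haarU N : ℝ) : ℂ) =
      (toeplitz N fun t => (χ n t : ℂ) * (‖f t‖ : ℂ)).det := by
    intro n
    rw [← (hnorm n).2, ← integral_complex_ofReal]
    refine integral_congr_ae (Eventually.of_forall fun U => ?_)
    simp only [norm_spectralProd, hnormeq]
  have hI : Integrable (fun U : Matrix.unitaryGroup (Fin N) ℂ => spectralProd f U.1) (haarU N) := by
    refine ⟨aestronglyMeasurable_of_tendsto_ae _ hmeas (Eventually.of_forall hpt), ?_⟩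
    have hfatou := lintegral_liminf_le' (μ := haarU N) (u := atTop) fun n => (hmeas n).enorm
    simp only [fun U => (hpt U).enorm.liminf_eq] at hfatou
    refine lt_of_le_of_lt hfatou (lt_top_iff_ne_top.2 ?_)
    have h1 : Tendsto (fun n => ∫ U, ‖spectralProd (p n) U.1‖ ∂haarU N) atTop
        (𝓝 (toeplitz N fun t => (‖f t‖ : ℂ)).det.re) := by
      have := (Complex.continuous_re.tendsto _).comp hlimnorm
      refine this.congr fun n => ?_
      rw [Function.comp_apply, ← hintnorm, Complex.ofReal_re]
    have h2 : ∀ n, ∫⁻ U, ‖spectralProd (p n) U.1‖ₑ ∂haarU N =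
        ENNReal.ofReal (∫ U, ‖spectralProd (p n) U.1‖ ∂haarU N) := fun n =>
      (ofReal_integral_norm_eq_lintegral_enorm (hp n).1).symm
    simp only [h2]
    refine ne_of_eq_of_ne ((ENNReal.continuous_ofReal.tendsto _).comp h1).liminf_eq ?_
    exact ENNReal.ofReal_ne_top
  refine ⟨hI, ?_⟩
  -- The limit function, now known to be integrable, dominates its own truncations.
  have h1 := tendsto_integral_of_dominated_convergence (μ := haarU N)
    (fun U => ‖spectralProd f U.1‖) hmeas hI.norm
    (fun n => Eventually.of_forall fun U => norm_spectralProd_mono fun t _ => hle n t)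
    (Eventually.of_forall hpt)
  refine tendsto_nhds_unique h1 ?_
  have h2 : ∀ n, ∫ U, spectralProd (p n) U.1 ∂haarU N = (toeplitz N (p n)).det := fun n => (hp n).2
  simp only [h2]
  exact tendsto_det_toeplitz (G := fun x => ‖circleRestrict f x‖)
    (fun n => (hcont f hf n).aestronglyMeasurable) hint.norm (fun n x => hle n _) fun t _ => hlim t

end HeineSzego

/-! ### Fourier coefficients of powers of `1 + z` -/

section FourierCoefficients

theorem haarAddCircle_eq_volume :
    (AddCircle.haarAddCircle : Measure UnitAddCircle) = volume := by
  rw [AddCircle.volume_eq_smul_haarAddCircle]; simp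

theorem continuous_coe_toCircle :
    Continuous fun x : UnitAddCircle => (AddCircle.toCircle x : ℂ) :=
  continuous_subtype_val.comp AddCircle.continuous_toCircle

theorem ae_toCircle_ne (z : ℂ) : ∀ᵐ x : UnitAddCircle ∂AddCircle.haarAddCircle,
    (AddCircle.toCircle x : ℂ) ≠ z := by
  rw [haarAddCircle_eq_volume, ae_iff]
  have hs : {x : UnitAddCircle | ¬(AddCircle.toCircle x : ℂ) ≠ z}.Subsingleton := by
    intro x hx y hy
    simp only [ne_eq, not_not, Set.mem_ofPred_eq] at hx hy
    exact AddCircle.injective_toCircle one_ne_zero (Subtype.ext (hx.trans hy.symm))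
  have hnt : Nontrivial UnitAddCircle := by
    obtain ⟨x, hx⟩ := exists_toCircle_eq (t := 1) (by simp)
    obtain ⟨y, hy⟩ := exists_toCircle_eq (t := -1) (by simp)
    refine ⟨x, y, fun h => ?_⟩
    rw [h, hy] at hx
    norm_num at hx
  exact hs.measure_zero _

theorem norm_one_add_toCircle (x : ℝ) :
    ‖1 + (AddCircle.toCircle (x : UnitAddCircle) : ℂ)‖ = 2 * |Real.sin (Real.pi * (x + 1 / 2))| := by
  have h := Complex.norm_exp_I_mul_ofReal_sub_one (2 * Real.pi * (x + 1 / 2))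
  have h2 : Complex.exp (Complex.I * ((2 * Real.pi * (x + 1 / 2) : ℝ) : ℂ)) =
      -(AddCircle.toCircle (x : UnitAddCircle) : ℂ) := by
    rw [AddCircle.toCircle_apply_mk, Circle.coe_exp]
    have : Complex.I * ((2 * Real.pi * (x + 1 / 2) : ℝ) : ℂ) =
        ((2 * Real.pi / 1 * x : ℝ) : ℂ) * Complex.I + Real.pi * Complex.I := by
      push_cast; ring
    rw [this, Complex.exp_add, Complex.exp_pi_mul_I]
    ring
  rw [h2] at h
  rw [← norm_neg, neg_add, add_comm, ← sub_eq_add_neg, h, Real.norm_eq_abs, abs_mul, abs_two]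
  congr 3
  ring

/-- `|1 + z|^a` is integrable over the unit circle for `a > -1`. -/
theorem integrable_norm_one_add_rpow {a : ℝ} (ha : -1 < a) :
    Integrable (fun x : UnitAddCircle => ‖1 + (AddCircle.toCircle x : ℂ)‖ ^ a)
      AddCircle.haarAddCircle := by
  have hcn : Continuous fun x : UnitAddCircle => ‖1 + (AddCircle.toCircle x : ℂ)‖ :=
    (continuous_const.add continuous_coe_toCircle).norm
  rcases le_or_gt 0 a with h0 | h0
  · exact (hcn.rpow_const fun x => Or.inr h0).integrable_of_hasCompactSupport
      (HasCompactSupport.of_compactSpace _)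
  have hm : AEStronglyMeasurable (fun x : UnitAddCircle => ‖1 + (AddCircle.toCircle x : ℂ)‖ ^ a)
      volume := (hcn.measurable.pow_const a).aestronglyMeasurable
  -- The fundamental domain `(-1/2, 1/2]` places the singular point `z = -1` at its endpoints, where
  -- the integrand is compared with `(x + 1/2)^a` and `(1/2 - x)^a`.
  rw [haarAddCircle_eq_volume,
    ← (UnitAddCircle.measurePreserving_mk (-(1 / 2))).integrable_comp hm]
  have hI : IntervalIntegrable (fun x : ℝ => x ^ a) volume 0 1 :=
    intervalIntegral.intervalIntegrable_rpow' ha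
  have h1 : IntegrableOn (fun x : ℝ => (x + 1 / 2) ^ a) (Set.Ioc (-(1 / 2)) (-(1 / 2) + 1)) := by
    have := hI.comp_add_right (1 / 2)
    rw [intervalIntegrable_iff_integrableOn_Ioc_of_le (by norm_num)] at this
    rwa [show (0 : ℝ) - 1 / 2 = -(1 / 2) by norm_num,
      show (1 : ℝ) - 1 / 2 = -(1 / 2) + 1 by norm_num] at this
  have h2 : IntegrableOn (fun x : ℝ => (1 / 2 - x) ^ a) (Set.Ioc (-(1 / 2)) (-(1 / 2) + 1)) := by
    have := (hI.comp_sub_left (1 / 2)).symm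
    rw [intervalIntegrable_iff_integrableOn_Ioc_of_le (by norm_num)] at this
    rwa [show (1 : ℝ) / 2 - 1 = -(1 / 2) by norm_num,
      show (1 : ℝ) / 2 - 0 = -(1 / 2) + 1 by norm_num] at this
  refine (h1.add h2).mono' (hm.comp_measurePreserving
    (UnitAddCircle.measurePreserving_mk (-(1 / 2)))) ?_
  filter_upwards [ae_restrict_mem measurableSet_Ioc] with x hx
  have hx1 : 0 < x + 1 / 2 := by linarith [hx.1]
  have hx2 : 0 ≤ 1 / 2 - x := by linarith [hx.2]
  have hp1 : 0 ≤ (x + 1 / 2) ^ a := Real.rpow_nonneg hx1.le a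
  have hp2 : 0 ≤ (1 / 2 - x) ^ a := Real.rpow_nonneg hx2 a
  change ‖‖1 + (AddCircle.toCircle (x : UnitAddCircle) : ℂ)‖ ^ a‖ ≤
    (x + 1 / 2) ^ a + (1 / 2 - x) ^ a
  rw [Real.norm_of_nonneg (Real.rpow_nonneg (norm_nonneg _) a), norm_one_add_toCircle]
  have hpi := Real.pi_pos
  -- Jordan's inequality; the comparison below uses the endpoint nearer to `x`.
  have hsin : ∀ y : ℝ, 0 ≤ y → y ≤ 1 / 2 → 2 * y ≤ Real.sin (Real.pi * y) := by
    intro y h0 h1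
    have := Real.mul_le_sin (x := Real.pi * y) (by positivity) (by nlinarith)
    have e : 2 / Real.pi * (Real.pi * y) = 2 * y := by field_simp
    linarith
  rcases le_total x 0 with hx0 | hx0
  · have h3 := hsin (x + 1 / 2) hx1.le (by linarith)
    have h4 : x + 1 / 2 ≤ 2 * |Real.sin (Real.pi * (x + 1 / 2))| := by
      have := le_abs_self (Real.sin (Real.pi * (x + 1 / 2)))
      linarith
    have := Real.rpow_le_rpow_of_nonpos hx1 h4 h0.le
    linarith
  · have h5 : Real.sin (Real.pi * (x + 1 / 2)) = Real.sin (Real.pi * (1 / 2 - x)) := by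
      rw [← Real.sin_pi_sub]; congr 1; ring
    rw [h5]
    rcases hx2.eq_or_lt with h6 | h6
    · rw [← h6]
      simp only [mul_zero, Real.sin_zero, abs_zero]
      linarith
    · have h3 := hsin (1 / 2 - x) hx2 (by linarith)
      have h4 : 1 / 2 - x ≤ 2 * |Real.sin (Real.pi * (1 / 2 - x))| := by
        have := le_abs_self (Real.sin (Real.pi * (1 / 2 - x)))
        linarith
      have := Real.rpow_le_rpow_of_nonpos h6 h4 h0.le
      linarith

/-- A bound uniform in `r`, serving as the dominating function for `r → 1`. It rests on `|w^α| =
|w|^{Re α} e^{-arg(w) Im α}` with `|arg w| ≤ π`, and on `|1 + z|/2 ≤ |1 + rz| ≤ 2`. -/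
theorem norm_one_add_smul_cpow_le (α : ℂ) {r : ℝ} (hr0 : 0 ≤ r) (hr1 : r ≤ 1) {z : ℂ}
    (hz : ‖z‖ = 1) (hz1 : z ≠ -1) :
    ‖(1 + r * z) ^ α‖ ≤ Real.exp (Real.pi * |α.im|) * (2 ^ |α.re| * (1 + ‖1 + z‖ ^ α.re)) := by
  have hpos : 0 < ‖1 + z‖ := by
    rw [norm_pos_iff]
    intro h
    exact hz1 (by linear_combination h)
  have hrz : ‖(r : ℂ) * z‖ = r := by
    rw [norm_mul, hz, mul_one, Complex.norm_real, Real.norm_of_nonneg hr0]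
  -- Since `|1 + z| ≤ |1 + rz| + (1 - r)` and `1 - r ≤ |1 + rz|`.
  have hge : ‖1 + z‖ / 2 ≤ ‖1 + r * z‖ := by
    have h1 : 1 - r ≤ ‖1 + r * z‖ := by
      have := norm_sub_norm_le (1 : ℂ) (-(r * z))
      rw [norm_one, norm_neg, hrz, sub_neg_eq_add] at this
      exact this
    have h2 : ‖1 + z‖ ≤ ‖1 + r * z‖ + (1 - r) := by
      calc ‖1 + z‖ = ‖(1 + r * z) + ((1 - r : ℝ) : ℂ) * z‖ := by congr 1; push_cast; ring
        _ ≤ ‖1 + r * z‖ + ‖((1 - r : ℝ) : ℂ) * z‖ := norm_add_le _ _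
        _ = ‖1 + r * z‖ + (1 - r) := by
          rw [norm_mul, hz, mul_one, Complex.norm_real, Real.norm_of_nonneg (by linarith)]
    linarith
  have hle : ‖1 + r * z‖ ≤ 2 := by
    have := norm_add_le (1 : ℂ) (r * z)
    rw [norm_one, hrz] at this
    linarith
  have hne : 1 + r * z ≠ 0 := by
    rw [← norm_pos_iff]
    linarith
  rw [Complex.norm_cpow_of_ne_zero hne, div_eq_mul_inv, ← Real.exp_neg, mul_comm]
  have hexp : Real.exp (-((1 + r * z).arg * α.im)) ≤ Real.exp (Real.pi * |α.im|) := by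
    refine Real.exp_le_exp.2 ?_
    calc -((1 + r * z).arg * α.im) ≤ |(1 + r * z).arg * α.im| := neg_le_abs _
      _ = |(1 + r * z).arg| * |α.im| := abs_mul _ _
      _ ≤ Real.pi * |α.im| := by gcongr; exact Complex.abs_arg_le_pi _
  have hz0 : 0 ≤ ‖1 + z‖ ^ α.re := Real.rpow_nonneg (norm_nonneg _) _
  have h20 : (0 : ℝ) ≤ 2 ^ |α.re| := Real.rpow_nonneg zero_le_two _
  refine mul_le_mul hexp ?_ (Real.rpow_nonneg (norm_nonneg _) _) (Real.exp_nonneg _)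
  rcases le_total 0 α.re with h | h
  · calc ‖1 + r * z‖ ^ α.re ≤ 2 ^ α.re := Real.rpow_le_rpow (norm_nonneg _) hle h
      _ = 2 ^ |α.re| := by rw [abs_of_nonneg h]
      _ ≤ 2 ^ |α.re| * (1 + ‖1 + z‖ ^ α.re) := le_mul_of_one_le_right h20 (by linarith)
  · calc ‖1 + r * z‖ ^ α.re ≤ (‖1 + z‖ / 2) ^ α.re :=
          Real.rpow_le_rpow_of_nonpos (by positivity) hge h
      _ = 2 ^ |α.re| * ‖1 + z‖ ^ α.re := by
          rw [Real.div_rpow (norm_nonneg _) zero_le_two, abs_of_nonpos h,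
            Real.rpow_neg zero_le_two, div_eq_mul_inv, mul_comm]
      _ ≤ 2 ^ |α.re| * (1 + ‖1 + z‖ ^ α.re) := by gcongr; linarith

theorem one_add_smul_mem_slitPlane {r : ℝ} (hr0 : 0 ≤ r) (hr1 : r ≤ 1) {z : ℂ}
    (hz : ‖z‖ = 1) (hz1 : z ≠ -1) : 1 + r * z ∈ Complex.slitPlane := by
  rw [Complex.mem_slitPlane_iff]
  left
  have h1 : -1 < z.re := by
    have h2 := Complex.sq_norm z
    rw [hz, Complex.normSq_apply] at h2
    have h3 : -1 ≤ z.re := by nlinarith [mul_self_nonneg z.im]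
    refine lt_of_le_of_ne h3 fun h => hz1 ?_
    have h4 : z.im = 0 := by rw [← h] at h2; nlinarith
    exact Complex.ext (by simp [← h]) (by simp [h4])
  simp only [Complex.add_re, Complex.one_re, Complex.mul_re, Complex.ofReal_re, Complex.ofReal_im,
    zero_mul, sub_zero]
  rcases le_or_gt 0 z.re with h | h
  · positivity
  · nlinarith

/-- Fourier coefficients of an integrable function times an absolutely convergent power series. -/
theorem fourierCoeff_mul_tsum {F : UnitAddCircle → ℂ}
    (hF : Integrable F AddCircle.haarAddCircle) {c : ℕ → ℂ} (hc : Summable fun n => ‖c n‖) (m : ℤ) :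
    fourierCoeff (fun x => F x * ∑' n : ℕ, c n * (AddCircle.toCircle x : ℂ) ^ n) m =
      ∑' n : ℕ, c n * fourierCoeff F (m - n) := by
  let G : ℕ → UnitAddCircle → ℂ := fun n x => c n * (fourier (-(m - n)) x • F x)
  have hint : ∀ n, Integrable (G n) AddCircle.haarAddCircle := fun n =>
    (hF.fourier_smul _).const_mul _
  have hnorm : ∀ n, ∫ x, ‖G n x‖ ∂AddCircle.haarAddCircle =
      ‖c n‖ * ∫ x, ‖F x‖ ∂AddCircle.haarAddCircle := by
    intro n
    rw [← integral_const_mul]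
    refine integral_congr_ae (Eventually.of_forall fun x => ?_)
    simp only [G]
    rw [norm_mul, norm_smul, fourier_apply, Circle.norm_coe, one_mul]
  have hs : Summable fun n => ∫ x, ‖G n x‖ ∂AddCircle.haarAddCircle := by
    simp only [hnorm]
    exact hc.mul_right _
  have h := (hasSum_integral_of_summable_integral_norm hint hs).tsum_eq
  have hL : ∀ n, ∫ x, G n x ∂AddCircle.haarAddCircle = c n * fourierCoeff F (m - n) := fun n =>
    integral_const_mul _ _
  simp only [hL] at h
  rw [h, fourierCoeff]
  refine integral_congr_ae (Eventually.of_forall fun x => ?_)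
  simp only [G]
  rw [smul_eq_mul, ← mul_assoc, ← tsum_mul_left]
  refine tsum_congr fun n => ?_
  rw [neg_sub, sub_eq_add_neg, fourier_add, smul_eq_mul]
  have : fourier (n : ℤ) x = (AddCircle.toCircle x : ℂ) ^ n := by
    rw [fourier_apply, AddCircle.toCircle_zsmul, Circle.coe_zpow, zpow_natCast]
  rw [this]
  ring

/-- Written for `1/Γ` the recurrence holds at the poles too, so the inductions below need no
exceptional cases. -/
theorem Gamma_inv_recurrence (w : ℂ) :
    w * (Complex.Gamma (w + 1))⁻¹ = (Complex.Gamma w)⁻¹ :=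
  (Complex.one_div_Gamma_eq_self_mul_one_div_Gamma_add_one w).symm

theorem complexBinom_intCast_of_neg (α : ℂ) {n : ℤ} (hn : n < 0) : complexBinom α n = 0 := by
  obtain ⟨m, rfl⟩ : ∃ m : ℕ, n = -(m : ℤ) - 1 := ⟨(-n - 1).toNat, by omega⟩
  have : (((-(m : ℤ) - 1 : ℤ) : ℂ)) + 1 = -(m : ℂ) := by push_cast; ring
  -- At a pole `Complex.Gamma` has the value `0`, and division by zero gives `0`, in agreement with
  -- `1/Γ = 0`.
  rw [complexBinom, this, Complex.Gamma_neg_nat_eq_zero]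
  simp

/-- The falling factorial is `Γ(α+1)/Γ(α-n+1)`. The hypothesis on `α` makes `Γ(α+1)` nonzero, as the
case `n = 0` requires. -/
theorem ringChoose_eq_complexBinom {α : ℂ} (hα : -1 < α.re) (n : ℕ) :
    Ring.choose α n = complexBinom α n := by
  have h0 : Complex.Gamma (α + 1) ≠ 0 := by
    refine Complex.Gamma_ne_zero_of_re_pos ?_
    simp only [Complex.add_re, Complex.one_re]
    linarith
  have key : (descPochhammer ℤ n).smeval α =
      Complex.Gamma (α + 1) * (Complex.Gamma (α - n + 1))⁻¹ := by
    induction n with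
    | zero => simp [h0]
    | succ n ih =>
      rw [descPochhammer_succ_right, Polynomial.smeval_mul, ih]
      have h1 : ((Polynomial.X - (n : Polynomial ℤ)).smeval α) = α - n := by
        rw [Polynomial.smeval_sub, Polynomial.smeval_X, pow_one, Polynomial.smeval_natCast]
        simp
      have h2 : α - ((n + 1 : ℕ) : ℂ) + 1 = α - n := by push_cast; ring
      rw [h1, h2, ← Gamma_inv_recurrence (α - n)]
      ring
  rw [Ring.descPochhammer_eq_factorial_smul_choose, nsmul_eq_mul] at key
  have hn : (n.factorial : ℂ) ≠ 0 := by exact_mod_cast n.factorial_ne_zero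
  rw [complexBinom, Complex.Gamma_nat_eq_factorial, div_eq_mul_inv, mul_inv, mul_left_comm, ← key,
    inv_mul_cancel_left₀ hn]

/-- By `(-1)^l (s-α)_l / Γ(α-s+1) = 1/Γ(α-s-l+1)`, the Kummer series is a sum of binomial
coefficients, hence a convolution of Fourier coefficients. -/
theorem kummer_term_eq_complexBinom (α s : ℂ) (l : ℕ) :
    (-1) ^ l * (Complex.Gamma (α + 1) / Complex.Gamma (α - s + 1) *
      ((ascPochhammer ℂ l).eval (s - α) / Complex.Gamma (s + 1 + l))) =
    complexBinom α (s + l) := by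
  have key : (-1) ^ l * (ascPochhammer ℂ l).eval (s - α) * (Complex.Gamma (α - s + 1))⁻¹ =
      (Complex.Gamma (α - (s + l) + 1))⁻¹ := by
    induction l with
    | zero => simp
    | succ l ih =>
      have h : α - (s + (l + 1 : ℕ)) + 1 = α - (s + l) := by push_cast; ring
      rw [h, ← Gamma_inv_recurrence (α - (s + l)), ← ih, ascPochhammer_succ_eval]
      ring
  have h : s + 1 + l = s + l + 1 := by ring
  rw [complexBinom, div_eq_mul_inv _ (_ * _), mul_inv, ← key, h]
  ring

/-- Inside the unit disc the binomial series converges absolutely, so the coefficients can be read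
off. -/
theorem fourierCoeff_one_add_smul_cpow {α : ℂ} (hα : -1 < α.re) {r : ℝ} (hr0 : 0 < r) (hr1 : r < 1)
    (m : ℤ) : fourierCoeff (fun x : UnitAddCircle => (1 + r * (AddCircle.toCircle x : ℂ)) ^ α) m =
      complexBinom α m * (r : ℂ) ^ m := by
  have hsum : ∀ z : ℂ, ‖z‖ < 1 → HasSum (fun n => Ring.choose α n * z ^ n) ((1 + z) ^ α) := by
    intro z hz
    have h1 := (Complex.one_add_cpow_hasFPowerSeriesOnBall_zero (a := α)).hasSum (y := z) (by
      rw [← ENNReal.ofReal_one, Metric.eball_ofReal]; simpa using hz)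
    rw [zero_add] at h1
    simpa only [binomialSeries, FormalMultilinearSeries.ofScalars_apply_eq, smul_eq_mul] using h1
  have hrn : ‖(r : ℂ)‖ < 1 := by rwa [Complex.norm_real, Real.norm_of_nonneg hr0.le]
  have hc : Summable fun n => ‖Ring.choose α n * (r : ℂ) ^ n‖ := (hsum r hrn).summable.norm
  have h := fourierCoeff_mul_tsum (F := fun _ => 1) (integrable_const 1) hc m
  have hone : fourierCoeff (fun _ : UnitAddCircle => (1 : ℂ)) = Pi.single 0 1 := by
    rw [← fourierCoeff_fourier (T := 1) 0]
    congr 1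
    ext x
    simp
  have hL : (fun x : UnitAddCircle => (1 : ℂ) * ∑' n : ℕ, Ring.choose α n * (r : ℂ) ^ n *
      (AddCircle.toCircle x : ℂ) ^ n) = fun x => (1 + r * (AddCircle.toCircle x : ℂ)) ^ α := by
    ext x
    rw [one_mul, ← (hsum (r * (AddCircle.toCircle x : ℂ)) (by
      rwa [norm_mul, Circle.norm_coe, mul_one])).tsum_eq]
    exact tsum_congr fun n => by ring
  rw [hL, hone] at h
  rw [h]
  rcases lt_or_ge m 0 with hm | hm
  · rw [complexBinom_intCast_of_neg α hm, zero_mul]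
    refine (tsum_congr fun n => ?_).trans tsum_zero
    rw [Pi.single_eq_of_ne (by omega), mul_zero]
  · lift m to ℕ using hm
    rw [tsum_eq_single m]
    · simp [ringChoose_eq_complexBinom hα]
    · intro n hn
      rw [Pi.single_eq_of_ne (by omega), mul_zero]

theorem integrable_cpowBound (α : ℂ) (hα : -1 < α.re) :
    Integrable (fun x : UnitAddCircle => Real.exp (Real.pi * |α.im|) *
      (2 ^ |α.re| * (1 + ‖1 + (AddCircle.toCircle x : ℂ)‖ ^ α.re))) AddCircle.haarAddCircle :=
  (((integrable_const 1).add (integrable_norm_one_add_rpow hα)).const_mul _).const_mul _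

theorem measurable_one_add_smul_cpow (α : ℂ) (r : ℂ) :
    Measurable fun x : UnitAddCircle => (1 + r * (AddCircle.toCircle x : ℂ)) ^ α :=
  (continuous_const.add (continuous_const.mul continuous_coe_toCircle)).measurable.pow_const α

theorem integrable_one_add_cpow {α : ℂ} (hα : -1 < α.re) :
    Integrable (fun x : UnitAddCircle => (1 + (AddCircle.toCircle x : ℂ)) ^ α)
      AddCircle.haarAddCircle := by
  have hm := measurable_one_add_smul_cpow α 1
  simp only [one_mul] at hm
  refine (integrable_cpowBound α hα).mono' hm.aestronglyMeasurable ?_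
  filter_upwards [ae_toCircle_ne (-1)] with x hx
  simpa using norm_one_add_smul_cpow_le α zero_le_one le_rfl (Circle.norm_coe _) hx

/-- The Fourier coefficients of `(1 + z)^α` are binomial coefficients. -/
theorem fourierCoeff_one_add_cpow {α : ℂ} (hα : -1 < α.re) (m : ℤ) :
    fourierCoeff (fun x : UnitAddCircle => (1 + (AddCircle.toCircle x : ℂ)) ^ α) m =
      complexBinom α m := by
  -- Any sequence in `(0, 1)` tending to `1` would do; the shift by `2` keeps `r 0` positive.
  let r : ℕ → ℝ := fun k => 1 - 1 / ((k : ℝ) + 2)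
  have hk : ∀ k : ℕ, 0 < 1 / ((k : ℝ) + 2) ∧ 1 / ((k : ℝ) + 2) < 1 := fun k => by
    have : (0 : ℝ) ≤ k := Nat.cast_nonneg k
    exact ⟨by positivity, by rw [div_lt_one (by positivity)]; linarith⟩
  have hr0 : ∀ k, 0 < r k := fun k => by simp only [r]; linarith [(hk k).2]
  have hr1 : ∀ k, r k < 1 := fun k => by simp only [r]; linarith [(hk k).1]
  have hr : Tendsto r atTop (𝓝 1) := by
    have h1 : Tendsto (fun k : ℕ => 1 / ((k : ℝ) + 2)) atTop (𝓝 0) := by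
      have := (tendsto_one_div_add_atTop_nhds_zero_nat (𝕜 := ℝ)).comp (tendsto_add_atTop_nat 1)
      refine this.congr fun k => ?_
      simp only [Function.comp_apply]
      push_cast
      congr 1
      ring
    simpa [r] using h1.const_sub 1
  have hrC : Tendsto (fun k => (r k : ℂ)) atTop (𝓝 1) := by
    have := (Complex.continuous_ofReal.tendsto 1).comp hr
    rwa [Complex.ofReal_one] at this
  have h1 : Tendsto (fun k => fourierCoeff
      (fun x : UnitAddCircle => (1 + r k * (AddCircle.toCircle x : ℂ)) ^ α) m) atTop
      (𝓝 (fourierCoeff (fun x : UnitAddCircle => (1 + (AddCircle.toCircle x : ℂ)) ^ α) m)) := by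
    refine tendsto_integral_of_dominated_convergence _ (fun k => ?_) (integrable_cpowBound α hα)
      (fun k => ?_) ?_
    · exact (map_continuous (fourier (-m))).aestronglyMeasurable.smul
        (measurable_one_add_smul_cpow α (r k)).aestronglyMeasurable
    · filter_upwards [ae_toCircle_ne (-1)] with x hx
      rw [norm_smul, fourier_apply, Circle.norm_coe, one_mul]
      exact norm_one_add_smul_cpow_le α (hr0 k).le (hr1 k).le (Circle.norm_coe _) hx
    · filter_upwards [ae_toCircle_ne (-1)] with x hx
      refine Tendsto.const_smul ?_ _
      have hs := one_add_smul_mem_slitPlane zero_le_one le_rfl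
        (Circle.norm_coe (AddCircle.toCircle x)) hx
      simp only [Complex.ofReal_one, one_mul] at hs
      refine (continuousAt_cpow_const hs).tendsto.comp ?_
      simpa using (hrC.mul_const (AddCircle.toCircle x : ℂ)).const_add 1
  have h2 : Tendsto (fun k => complexBinom α m * (r k : ℂ) ^ m) atTop
      (𝓝 (complexBinom α m * 1 ^ m)) :=
    (hrC.zpow₀ m (Or.inl one_ne_zero)).const_mul _
  rw [one_zpow, mul_one] at h2
  refine tendsto_nhds_unique h1 (h2.congr fun k => ?_)
  exact (fourierCoeff_one_add_smul_cpow hα (hr0 k) (hr1 k) m).symm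

variable {ε : ℂ}

/-- The substitution `z ↦ ε/z` is the reflection `x ↦ c - x`, which preserves Haar measure. It
carries the results on `(1 + z)^α` over to `(1 + ε/z)^α`. -/
theorem exists_toCircle_sub (hε : ε = 1 ∨ ε = -1) : ∃ c : UnitAddCircle, ∀ x,
    (AddCircle.toCircle (c - x) : ℂ) = ε * (AddCircle.toCircle x : ℂ)⁻¹ := by
  obtain ⟨c, hc⟩ := exists_toCircle_eq (t := ε) (by rcases hε with rfl | rfl <;> simp)
  refine ⟨c, fun x => ?_⟩
  rw [sub_eq_add_neg, AddCircle.toCircle_add, AddCircle.toCircle_neg, Circle.coe_mul, hc,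
    Circle.coe_inv]

theorem integrable_one_add_inv_cpow {α : ℂ} (hα : -1 < α.re) (hε : ε = 1 ∨ ε = -1) :
    Integrable (fun x : UnitAddCircle => (1 + ε * (AddCircle.toCircle x : ℂ)⁻¹) ^ α)
      AddCircle.haarAddCircle := by
  obtain ⟨c, hc⟩ := exists_toCircle_sub hε
  simpa only [hc] using (integrable_one_add_cpow hα).comp_sub_left c

theorem fourierCoeff_one_add_inv_cpow {α : ℂ} (hα : -1 < α.re) (hε : ε = 1 ∨ ε = -1) (m : ℤ) :
    fourierCoeff (fun x : UnitAddCircle => (1 + ε * (AddCircle.toCircle x : ℂ)⁻¹) ^ α) m =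
      ε ^ m * complexBinom α (-m : ℤ) := by
  obtain ⟨c, hc⟩ := exists_toCircle_sub hε
  have hε2 : ε * ε = 1 := by rcases hε with rfl | rfl <;> simp
  rw [← fourierCoeff_one_add_cpow hα, fourierCoeff, fourierCoeff, ← integral_const_mul,
    ← integral_sub_left_eq_self _ AddCircle.haarAddCircle c]
  refine integral_congr_ae (Eventually.of_forall fun x => ?_)
  simp only [fourier_apply, AddCircle.toCircle_zsmul, Circle.coe_zpow, hc, smul_eq_mul, neg_neg]
  have hx : (AddCircle.toCircle x : ℂ) ≠ 0 := Circle.coe_ne_zero _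
  have hε0 : ε ≠ 0 := left_ne_zero_of_mul_eq_one hε2
  have h1 : ε * (ε * (AddCircle.toCircle x : ℂ)⁻¹)⁻¹ = AddCircle.toCircle x := by field_simp
  have h2 : (ε * (AddCircle.toCircle x : ℂ)⁻¹)⁻¹ = ε * AddCircle.toCircle x := by
    rw [mul_inv, inv_inv, inv_eq_of_mul_eq_one_left hε2]
  rw [h1, zpow_neg, ← inv_zpow, h2, mul_zpow, mul_assoc]

end FourierCoefficients

/-! ### The symbol of the integrand -/

section BinomialSymbol

variable {N : ℕ}

/-- As `U† = U⁻¹`, the characteristic polynomial at `x` is the determinant of the Laurent polynomial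
`(x - 1) - ε U⁻¹` in `U`, which `det_sum_zpow` evaluates with multiplicities. -/
theorem roots_charpoly_one_add_smul_star (U : Matrix.unitaryGroup (Fin N) ℂ) (ε : ℂ) :
    (1 + ε • star U.1).charpoly.roots = U.1.charpoly.roots.map fun t => 1 + ε * t⁻¹ := by
  have h : (1 + ε • star U.1).charpoly =
      ((U.1.charpoly.roots.map fun t => 1 + ε * t⁻¹).map fun a =>
        Polynomial.X - Polynomial.C a).prod := by
    refine Polynomial.funext fun x => ?_
    have h1 := det_sum_zpow {0, -1} (fun s => if s = 0 then x - 1 else -ε) U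
    have hne : (0 : ℤ) ∉ ({-1} : Finset ℤ) := by simp
    simp only [Finset.sum_insert hne, Finset.sum_singleton, zpow_zero, OneMemClass.coe_one,
      zpow_neg, zpow_one, if_true, if_neg (show ¬((-1 : ℤ) = 0) by decide)] at h1
    have h2 : Matrix.scalar (Fin N) x - (1 + ε • star U.1) =
        (x - 1) • (1 : Matrix (Fin N) (Fin N) ℂ) + -ε • (U⁻¹).1 := by
      have : (U⁻¹).1 = star U.1 := rfl
      rw [this, Matrix.scalar_apply, ← Matrix.smul_one_eq_diagonal, sub_smul, neg_smul, one_smul]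
      abel
    rw [Matrix.eval_charpoly, h2, h1, spectralProd, Polynomial.eval_multiset_prod,
      Multiset.map_map, Multiset.map_map]
    refine congrArg _ (Multiset.map_congr rfl fun t _ => ?_)
    simp only [Function.comp_apply, Polynomial.eval_sub, Polynomial.eval_X, Polynomial.eval_C]
    ring
  rw [h, Polynomial.roots_multiset_prod_X_sub_C]

/-- The symbol whose product over the spectrum of `U` is the integrand. -/
noncomputable def binomialSymbol (ε α b t : ℂ) : ℂ := (1 + ε * t⁻¹) ^ α * Complex.exp (b * t)

theorem inghamSiegelIntegrand_eq_spectralProd (ε α b : ℂ) (U : Matrix.unitaryGroup (Fin N) ℂ) :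
    inghamSiegelIntegrand ε α b U = spectralProd (binomialSymbol ε α b) U.1 := by
  rw [inghamSiegelIntegrand, detCpow, roots_charpoly_one_add_smul_star, Multiset.map_map,
    Matrix.trace_eq_sum_roots_charpoly]
  have h : b * U.1.charpoly.roots.sum = (U.1.charpoly.roots.map fun t => b * t).sum := by
    rw [Multiset.sum_map_mul_left, Multiset.map_id']
  rw [h, Complex.exp_multiset_sum, Multiset.map_map, ← Multiset.prod_map_mul]
  rfl

theorem continuous_exp_mul_toCircle (b : ℂ) :
    Continuous fun x : UnitAddCircle => Complex.exp (b * AddCircle.toCircle x) :=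
  Complex.continuous_exp.comp (continuous_const.mul continuous_coe_toCircle)

variable {ε : ℂ}

theorem integrable_binomialSymbol {α : ℂ} (hα : -1 < α.re) (hε : ε = 1 ∨ ε = -1) (b : ℂ) :
    Integrable (circleRestrict (binomialSymbol ε α b)) AddCircle.haarAddCircle := by
  refine (integrable_one_add_inv_cpow hα hε).mul_bdd (c := Real.exp ‖b‖)
    (continuous_exp_mul_toCircle b).aestronglyMeasurable (Eventually.of_forall fun x => ?_)
  refine (Complex.norm_exp_le_exp_norm _).trans (Real.exp_le_exp.2 ?_)
  rw [norm_mul, Circle.norm_coe, mul_one]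

/-- The exponential series is convolved with the coefficients of `(1 + ε/z)^α`. The sign `ε^{m-n} =
ε^m ε^n` and the `(-1)^n` of `kummer_term_eq_complexBinom` turn `b^n` into `(-ε b)^n`. -/
theorem fourierCoeff_binomialSymbol {α : ℂ} (hα : -1 < α.re) (hε : ε = 1 ∨ ε = -1) (b : ℂ)
    (m : ℤ) : fourierCoeff (circleRestrict (binomialSymbol ε α b)) m =
      ε ^ m * binomKummer α (-m : ℤ) (-ε * b) := by
  have hε2 : ε * ε = 1 := by rcases hε with rfl | rfl <;> simp
  have hε0 : ε ≠ 0 := left_ne_zero_of_mul_eq_one hε2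
  have h := fourierCoeff_mul_tsum (integrable_one_add_inv_cpow hα hε)
    (c := fun n => b ^ n / n.factorial) (NormedSpace.norm_expSeries_div_summable b) m
  have hL : circleRestrict (binomialSymbol ε α b) = fun x =>
      (1 + ε * (AddCircle.toCircle x : ℂ)⁻¹) ^ α *
        ∑' n : ℕ, b ^ n / n.factorial * (AddCircle.toCircle x : ℂ) ^ n := by
    ext x
    rw [circleRestrict, binomialSymbol, Complex.exp_eq_exp_ℂ, NormedSpace.exp_eq_tsum_div]
    refine congrArg _ (tsum_congr fun n => ?_)
    rw [mul_pow]
    ring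
  rw [hL, h, binomKummer, ← mul_assoc, ← tsum_mul_left]
  refine tsum_congr fun n => ?_
  have h1 := kummer_term_eq_complexBinom α (-m : ℤ) n
  have h2 : ((-(m - n) : ℤ) : ℂ) = ((-m : ℤ) : ℂ) + n := by push_cast; ring
  have h3 : ε ^ (m - n : ℤ) = ε ^ m * ε ^ n := by
    rw [zpow_sub₀ hε0, zpow_natCast, div_eq_mul_inv, ← inv_pow, inv_eq_of_mul_eq_one_left hε2]
  rw [fourierCoeff_one_add_inv_cpow hα hε, h2, ← h1, h3, neg_mul, neg_pow (ε * b), mul_pow ε b]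
  ring

/-- The entries carry the factors `ε^{k-j} = ε^j ε^k`, a conjugation by the diagonal matrix of the
`ε^j`, which does not change the determinant. -/
theorem det_toeplitz_binomialSymbol {α : ℂ} (hα : -1 < α.re) (hε : ε = 1 ∨ ε = -1) (b : ℂ) :
    (toeplitz N (binomialSymbol ε α b)).det = Matrix.det (Matrix.of fun j k : Fin N =>
      binomKummer α (((j : ℕ) : ℂ) - ((k : ℕ) : ℂ)) (-ε * b)) := by
  have hε2 : ε * ε = 1 := by rcases hε with rfl | rfl <;> simp
  have hε0 : ε ≠ 0 := left_ne_zero_of_mul_eq_one hε2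
  have h : toeplitz N (binomialSymbol ε α b) = Matrix.of fun j k : Fin N => ε ^ (j : ℕ) *
      (Matrix.of fun j k : Fin N => ε ^ (k : ℕ) * (Matrix.of fun j k : Fin N =>
        binomKummer α (((j : ℕ) : ℂ) - ((k : ℕ) : ℂ)) (-ε * b)) j k) j k := by
    ext j k
    simp only [toeplitz, Matrix.of_apply]
    rw [fourierCoeff_binomialSymbol hα hε, zpow_sub₀ hε0, zpow_natCast, zpow_natCast,
      div_eq_mul_inv, ← inv_pow, inv_eq_of_mul_eq_one_left hε2]
    push_cast
    rw [neg_sub]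
    ring
  rw [h, Matrix.det_mul_column, Matrix.det_mul_row, ← mul_assoc, ← Finset.prod_mul_distrib]
  simp only [← mul_pow, hε2, one_pow, Finset.prod_const_one, one_mul]

theorem continuousAt_binomialSymbol (hε : ε = 1 ∨ ε = -1) (α b : ℂ) {x : UnitAddCircle}
    (hx : (AddCircle.toCircle x : ℂ) ≠ -ε) :
    ContinuousAt (circleRestrict (binomialSymbol ε α b)) x := by
  have hε2 : ε * ε = 1 := by rcases hε with rfl | rfl <;> simp
  have hx0 : (AddCircle.toCircle x : ℂ) ≠ 0 := Circle.coe_ne_zero _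
  have hs := one_add_smul_mem_slitPlane zero_le_one le_rfl
    (z := ε * (AddCircle.toCircle x : ℂ)⁻¹) (by
      rw [norm_mul, norm_inv, Circle.norm_coe]
      rcases hε with rfl | rfl <;> simp) fun h => hx (by
      rw [← div_eq_mul_inv, div_eq_iff hx0] at h
      rw [h, neg_one_mul, neg_neg])
  rw [Complex.ofReal_one, one_mul] at hs
  refine ContinuousAt.mul ?_ (continuous_exp_mul_toCircle b).continuousAt
  refine (continuousAt_const.add (continuousAt_const.mul
    (continuous_coe_toCircle.continuousAt.inv₀ hx0))).cpow continuousAt_const hs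

end BinomialSymbol

/-! ### The integral formula -/

theorem corollary2 (N : ℕ) (α b : ℂ) (hα : -1 < α.re) (ε : ℂ) (hε : ε = 1 ∨ ε = -1) :
    Integrable (inghamSiegelIntegrand (N := N) ε α b) (haarU N) ∧
      ∫ U, inghamSiegelIntegrand (N := N) ε α b U ∂(haarU N) =
        Matrix.det (Matrix.of fun j k : Fin N =>
          binomKummer α (((j : ℕ) : ℂ) - ((k : ℕ) : ℂ)) (-ε * b)) := by
  rw [← det_toeplitz_binomialSymbol hα hε,
    funext (inghamSiegelIntegrand_eq_spectralProd (N := N) ε α b)]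
  -- For `α = 0` the convention `0^0 = 1` keeps the symbol from vanishing at `-ε`, but it is then
  -- just the continuous function `e^{bt}`.
  by_cases h0 : α = 0
  · refine heineSzego_of_continuous ?_
    subst h0
    refine (continuous_exp_mul_toCircle b).congr fun x => ?_
    rw [circleRestrict, binomialSymbol, Complex.cpow_zero, one_mul]
  · refine heineSzego_of_continuousOn (t₀ := -ε) ?_
      (fun x hx => continuousAt_binomialSymbol hε α b hx) (integrable_binomialSymbol hα hε b)
    rcases hε with rfl | rfl <;> simp [binomialSymbol, h0]
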